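/- Let $N\ge 2$ be an integer, let $a\ge 0$ and $b>0$ be real constants, and let $f:\mathbb R\to\mathbb R$ satisfy - (f1) $f$ is continuous and odd; - (f2) $-\infty<\liminf_{t\to0} f(t)/t\le\limsup_{t\to0} f(t)/t<0$; - (f3) if $N\ge3$, then $\lim_{t\to\infty} f(t)/|t|^{\frac{N+2}{N-2}}=0$; if $N=2$, then $\lim_{t\to\infty} f(t)/e^{\alpha t^2}=0$ for every $\alpha>0$. Let $H^1_r(\mathbb R^N)$ be the subspace of the radially symmetric functions in $H^1(\mathbb R^N)$, with the norm $\|u\|^2=\int_{\mathbb R^N}|\nabla u|^2+\int_{\mathbb R^N}u^2$, put $F(t)=\int_0^t f(\tau)\,d\tau$, and define $\Phi:H^1_r(\mathbb R^N)\to\mathbb R$ by $$\Phi(u)=\frac a2\int_{\mathbb R^N}|\nabla u|^2+\frac b4\left(\int_{\mathbb R^N}|\nabla u|^2\right)^2-\int_{\mathbb R^N}F(u).$$ Let $(u_n)$ be a bounded sequence in $H^1_r(\mathbb R^N)$ that is a Palais–Smale sequence of $\Phi$, i.e. $(\Phi(u_n))$ is bounded in $\mathbb R$ and $\Phi'(u_n)\to0$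 in the dual space $(H^1_r(\mathbb R^N))^*$. Then $(u_n)$ has a subsequence that converges strongly in $H^1_r(\mathbb R^N)$ to some $u\in H^1_r(\mathbb R^N)$. -/

import Mathlib

open MeasureTheory Filter Topology
open scoped ContDiff RealInnerProductSpace

noncomputable section

namespace Kirchhoff

/-- `ℝ^N` with its Euclidean norm. -/
abbrev Space (N : ℕ) : Type := EuclideanSpace ℝ (Fin N)

/-- `g` is the weak (distributional) gradient of `u`: for every test function `φ ∈ C_c^∞(ℝ^N)`
and every direction `v`, `∫ u ∂_v φ = - ∫ (g · v) φ`. -/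
def IsWeakGradient {N : ℕ} (u : Space N → ℝ) (g : Space N → Space N) : Prop :=
  ∀ φ : Space N → ℝ, ContDiff ℝ ∞ φ → HasCompactSupport φ → ∀ v : Space N,
    ∫ x, u x * fderiv ℝ φ x v = - ∫ x, ⟪g x, v⟫ * φ x

theorem integrable_left {N : ℕ} (u : Lp ℝ 2 (volume : Measure (Space N)))
    {φ : Space N → ℝ} (hφ : ContDiff ℝ ∞ φ) (hc : HasCompactSupport φ) (v : Space N) :
    Integrable (fun x => u x * fderiv ℝ φ x v) := by
  have hcont : Continuous fun x => fderiv ℝ φ x v :=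
    (hφ.continuous_fderiv (by simp)).clm_apply continuous_const
  have hsupp : HasCompactSupport fun x => fderiv ℝ φ x v := hc.fderiv_apply (𝕜 := ℝ) v
  exact (Lp.memLp u).integrable_mul (q := 2) (hcont.memLp_of_hasCompactSupport hsupp)

theorem integrable_right {N : ℕ} (g : Lp (Space N) 2 (volume : Measure (Space N)))
    {φ : Space N → ℝ} (hφ : ContDiff ℝ ∞ φ) (hc : HasCompactSupport φ) (v : Space N) :
    Integrable (fun x => ⟪g x, v⟫ * φ x) :=
  ((Lp.memLp g).inner_const v).integrable_mul (q := 2) (hφ.continuous.memLp_of_hasCompactSupport hc)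

/-- The Sobolev space `H¹(ℝ^N)`: the pairs `(u, ∇u)` where `u ∈ L²(ℝ^N)` has a weak gradient
`∇u ∈ L²(ℝ^N; ℝ^N)`. (The weak gradient is determined by `u`.) The norm inherited from the
Hilbert sum is the standard one, `‖u‖² = ‖u‖₂² + ‖∇u‖₂²`. -/
def H1 (N : ℕ) : Submodule ℝ
    (WithLp 2 (Lp ℝ 2 (volume : Measure (Space N)) ×
      Lp (Space N) 2 (volume : Measure (Space N)))) where
  carrier := {w | IsWeakGradient (w.fst : Space N → ℝ) (w.snd : Space N → Space N)}
  zero_mem' := by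
    intro φ _ _ v
    have h1 : ∫ x, ((0 : Lp ℝ 2 (volume : Measure (Space N))) : Space N → ℝ) x *
        fderiv ℝ φ x v = 0 := by
      refine integral_eq_zero_of_ae ?_
      filter_upwards [Lp.coeFn_zero ℝ 2 (volume : Measure (Space N))] with x hx
      simp
    have h2 : ∫ x, ⟪((0 : Lp (Space N) 2 (volume : Measure (Space N))) :
        Space N → Space N) x, v⟫ * φ x = 0 := by
      refine integral_eq_zero_of_ae ?_
      filter_upwards [Lp.coeFn_zero (Space N) 2 (volume : Measure (Space N))] with x hx
      simp
    simp only [WithLp.zero_fst, WithLp.zero_snd]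
    rw [h1, h2, neg_zero]
  add_mem' := by
    intro w w' hw hw' φ hφ hc v
    have h1 : ∫ x, ((w.fst + w'.fst : Lp ℝ 2 (volume : Measure (Space N))) :
        Space N → ℝ) x * fderiv ℝ φ x v
        = ∫ x, (w.fst x * fderiv ℝ φ x v + w'.fst x * fderiv ℝ φ x v) := by
      refine integral_congr_ae ?_
      filter_upwards [Lp.coeFn_add w.fst w'.fst] with x hx
      rw [hx, Pi.add_apply, add_mul]
    have h2 : ∫ x, ⟪((w.snd + w'.snd : Lp (Space N) 2 (volume : Measure (Space N))) :
        Space N → Space N) x, v⟫ * φ x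
        = ∫ x, (⟪w.snd x, v⟫ * φ x + ⟪w'.snd x, v⟫ * φ x) := by
      refine integral_congr_ae ?_
      filter_upwards [Lp.coeFn_add w.snd w'.snd] with x hx
      rw [hx, Pi.add_apply, inner_add_left, add_mul]
    simp only [WithLp.add_fst, WithLp.add_snd]
    rw [h1, h2, integral_add (integrable_left _ hφ hc v) (integrable_left _ hφ hc v),
      integral_add (integrable_right _ hφ hc v) (integrable_right _ hφ hc v),
      hw φ hφ hc v, hw' φ hφ hc v, neg_add]
  smul_mem' := by
    intro c w hw φ hφ hc v
    have h1 : ∫ x, ((c • w.fst : Lp ℝ 2 (volume : Measure (Space N))) :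
        Space N → ℝ) x * fderiv ℝ φ x v = ∫ x, c * (w.fst x * fderiv ℝ φ x v) := by
      refine integral_congr_ae ?_
      filter_upwards [Lp.coeFn_smul c w.fst] with x hx
      rw [hx, Pi.smul_apply, smul_eq_mul, mul_assoc]
    have h2 : ∫ x, ⟪((c • w.snd : Lp (Space N) 2 (volume : Measure (Space N))) :
        Space N → Space N) x, v⟫ * φ x = ∫ x, c * (⟪w.snd x, v⟫ * φ x) := by
      refine integral_congr_ae ?_
      filter_upwards [Lp.coeFn_smul c w.snd] with x hx
      rw [hx, Pi.smul_apply, real_inner_smul_left, mul_assoc]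
    simp only [WithLp.smul_fst, WithLp.smul_snd]
    rw [h1, h2, integral_const_mul, integral_const_mul, hw φ hφ hc v, mul_neg]

/-- The function underlying an element of `H¹(ℝ^N)`. -/
def fn {N : ℕ} (w : H1 N) : Space N → ℝ := w.1.fst

/-- The weak gradient of an element of `H¹(ℝ^N)`. -/
def grad {N : ℕ} (w : H1 N) : Space N → Space N := w.1.snd

/-- The subspace `H¹_r(ℝ^N)` of the radial functions, i.e. those with `u(x) = u(|x|)`
(almost everywhere). It carries the norm of `H¹(ℝ^N)`. -/
def H1r (N : ℕ) : Submodule ℝ (H1 N) where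
  carrier := {w | ∃ ρ : ℝ → ℝ, fn w =ᵐ[volume] fun x => ρ ‖x‖}
  zero_mem' := ⟨0, Lp.coeFn_zero ℝ 2 (volume : Measure (Space N))⟩
  add_mem' := by
    rintro w w' ⟨ρ, hρ⟩ ⟨ρ', hρ'⟩
    refine ⟨ρ + ρ', ?_⟩
    filter_upwards [hρ, hρ', Lp.coeFn_add w.1.fst w'.1.fst]
      with x h h' hx
    have e : fn (w + w') x = fn w x + fn w' x := hx
    rw [e, h, h', Pi.add_apply]
  smul_mem' := by
    rintro c w ⟨ρ, hρ⟩
    refine ⟨c • ρ, ?_⟩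
    filter_upwards [hρ, Lp.coeFn_smul c w.1.fst] with x h hx
    have e : fn (c • w) x = c • fn w x := hx
    rw [e, h, Pi.smul_apply]

/-- Condition (f1): `f` is continuous and odd. -/
def F1 (f : ℝ → ℝ) : Prop := Continuous f ∧ Function.Odd f

/-- Condition (f2): `-∞ < liminf_{t → 0} f(t)/t ≤ limsup_{t → 0} f(t)/t < 0`. The lower and upper
limits are taken in the extended reals; the middle inequality is automatic. -/
def F2 (f : ℝ → ℝ) : Prop :=
  ⊥ < liminf (fun t : ℝ => ((f t / t : ℝ) : EReal)) (𝓝[≠] 0) ∧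
    limsup (fun t : ℝ => ((f t / t : ℝ) : EReal)) (𝓝[≠] 0) < 0

/-- Condition (f3), subcritical growth at infinity in dimension `N ≥ 2`. -/
def F3 (N : ℕ) (f : ℝ → ℝ) : Prop :=
  (3 ≤ N → Tendsto (fun t : ℝ => f t / |t| ^ (((N : ℝ) + 2) / ((N : ℝ) - 2))) atTop (𝓝 0)) ∧
    (N = 2 → ∀ α : ℝ, 0 < α → Tendsto (fun t : ℝ => f t / Real.exp (α * t ^ 2)) atTop (𝓝 0))

/-- The functional
`Φ(u) = (a/2) ∫ |∇u|² + (b/4) (∫ |∇u|²)² - ∫ F(u)`, `F(t) = ∫₀ᵗ f`, on `H¹_r(ℝ^N)`. -/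
def energy (N : ℕ) (a b : ℝ) (f : ℝ → ℝ) (u : H1r N) : ℝ :=
  1 / 2 * a * (∫ x, ‖grad (u : H1 N) x‖ ^ 2)
    + 1 / 4 * b * (∫ x, ‖grad (u : H1 N) x‖ ^ 2) ^ 2
    - ∫ x, ∫ τ in (0 : ℝ)..(fn (u : H1 N) x), f τ

/-- `u` is a Palais-Smale sequence of the `C¹` functional `I` on the normed space `X`: the values
`I(u_n)` are bounded, and the Fréchet derivatives `I'(u_n)` tend to `0` in the norm of the dual
space `X*`. Differentiability of `I` is deliberately not part of this condition. -/
def IsPalaisSmale {X : Type*} [NormedAddCommGroup X] [NormedSpace ℝ X]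
    (I : X → ℝ) (u : ℕ → X) : Prop :=
  (∃ C : ℝ, ∀ n, |I (u n)| ≤ C) ∧ Tendsto (fun n => fderiv ℝ I (u n)) atTop (𝓝 0)

end Kirchhoff

end

/-! ### The weak gradient tested against radial vector fields. -/

namespace Kirchhoff

/-! Pass to a weakly convergent subsequence w_n ⇀ v and test Φ'(w_n) with d_n = w_n − v. The
resulting number (a + b‖∇w_n‖²)⟨∇w_n, ∇d_n⟩ − ∫ f(w_n) d_n tends to 0. Since ‖∇w_n‖² = ‖∇d_n‖² +
‖∇v‖² + o(1), its first term is at least b‖∇d_n‖⁴ − o(1), even when a = 0. Condition (f2) gives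
f(t)t ≤ −m t² near 0, and `eventually_integral_nonlinear_le` yields limsup (∫ f(w_n) d_n + m ∫ w_n
d_n) ≤ 0. Hence b‖∇d_n‖⁴ + m‖d_n‖₂² → 0, which is the content of `tendsto_zero_of_palaisSmale_ineq`.

Compactness comes from one reproducing formula. A radial profile satisfies p(r) = ∫_r^{r+1} (p(s) −
(r+1−s) p'(s)) ds, and in polar coordinates the right side is, up to the area of the sphere, the
inner product of (u, ∇u) with (`kernel₁`, `kernel₂`) in L² × L²; see `ae_eq_radialMean`. Three facts
follow. Weak convergence implies convergence almost everywhere. There is a pointwise bound |u(x)| ≤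
K(|x|)‖u‖ with K(r)² proportional to ∫_r^{r+1} s^{1−N} ds, decaying at infinity (`ae_abs_fn_le`). A
Schur test on the kernel gives the Hardy-type inequality ∫ (1 + |x|^{−γ}) u² ≤ C‖u‖²
(`exists_weighted_bound`).

The pointwise bound converts the growth condition (f3) into this weight: when |t| ≤ A K(r), the
quantity |t|^{4/(N−2)} is at most a multiple of r^{−2} if N ≥ 3, and exp(αt²) ≤ 1 + 1/r for a
suitable α > 0 if N = 2. So |f(t)| ≤ ε|t|(1 + r^{−γ}) + D (`exists_subcritical_bound`), and the
Hardy inequality does the work of the Sobolev and Trudinger–Moser embeddings.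

The Palais–Smale condition is phrased with `fderiv`, which is 0 where no derivative exists, so the
differentiability of Φ is proved as well (`hasFDerivAt_pullbackEnergy`). -/

theorem contDiff_comp_norm {E : Type*} [NormedAddCommGroup E] [InnerProductSpace ℝ E]
    {ζ : ℝ → ℝ} (hζ : ContDiff ℝ ∞ ζ) (hs : tsupport ζ ⊆ Set.Ioi 0) :
    ContDiff ℝ ∞ fun y : E => ζ ‖y‖ := by
  rw [contDiff_iff_contDiffAt]
  intro y
  by_cases hy : y = 0
  · subst hy
    have h0 : (0 : ℝ) ∉ tsupport ζ := fun h => lt_irrefl (0 : ℝ) (hs h)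
    have h1 : ζ =ᶠ[𝓝 0] 0 := notMem_tsupport_iff_eventuallyEq.1 h0
    have h2 : Tendsto (fun y : E => ‖y‖) (𝓝 0) (𝓝 0) := by
      simpa using (continuous_norm (E := E)).tendsto 0
    have h3 : (fun y : E => ζ ‖y‖) =ᶠ[𝓝 0] fun _ => 0 := h2.eventually h1
    exact (contDiffAt_const (c := (0 : ℝ))).congr_of_eventuallyEq h3
  · exact hζ.contDiffAt.comp y (contDiffAt_norm ℝ hy)

theorem hasCompactSupport_comp_norm {E : Type*} [NormedAddCommGroup E] [ProperSpace E]
    {ζ : ℝ → ℝ} (hc : HasCompactSupport ζ) : HasCompactSupport fun y : E => ζ ‖y‖ := by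
  obtain ⟨R, hR⟩ := hc.isCompact.isBounded.subset_closedBall 0
  refine HasCompactSupport.intro (isCompact_closedBall (0 : E) R) fun y hy => ?_
  refine image_eq_zero_of_notMem_tsupport fun h => hy ?_
  simpa using hR h

/-- Euler's identity for a radial function. -/
theorem fderiv_comp_norm_self {E : Type*} [NormedAddCommGroup E] [InnerProductSpace ℝ E]
    {ζ : ℝ → ℝ} (hζ : ContDiff ℝ ∞ ζ) (hs : tsupport ζ ⊆ Set.Ioi 0) (y : E) :
    fderiv ℝ (fun y : E => ζ ‖y‖) y y = ‖y‖ * deriv ζ ‖y‖ := by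
  by_cases hy : y = 0
  · simp [hy]
  have hd : DifferentiableAt ℝ (fun y : E => ζ ‖y‖) y :=
    (contDiff_comp_norm hζ hs).differentiable (by simp) y
  -- Differentiate at t = 0 along the ray y + t y, whose norm is (1 + t)‖y‖ for t > −1.
  have h1 : HasDerivAt (fun t : ℝ => y + t • y) y 0 := by
    simpa using ((hasDerivAt_id (0 : ℝ)).smul_const y).const_add y
  have h2 : HasDerivAt (fun t : ℝ => ζ ‖y + t • y‖) (fderiv ℝ (fun y : E => ζ ‖y‖) y y) 0 :=
    HasFDerivAt.comp_hasDerivAt (0 : ℝ) (l := fun y : E => ζ ‖y‖) (f := fun t : ℝ => y + t • y)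
      (by simpa using hd.hasFDerivAt) h1
  have h3 : HasDerivAt (fun t : ℝ => (1 + t) * ‖y‖) ‖y‖ 0 := by
    simpa using ((hasDerivAt_id (0 : ℝ)).const_add 1).mul_const ‖y‖
  have h4 : HasDerivAt (fun t : ℝ => ζ ((1 + t) * ‖y‖)) (deriv ζ ‖y‖ * ‖y‖) 0 :=
    HasDerivAt.comp (0 : ℝ) (h₂ := ζ) (h := fun t : ℝ => (1 + t) * ‖y‖)
      (by simpa using (hζ.differentiable (by simp) ‖y‖).hasDerivAt) h3
  have h5 : (fun t : ℝ => ζ ‖y + t • y‖) =ᶠ[𝓝 0] fun t => ζ ((1 + t) * ‖y‖) := by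
    filter_upwards [eventually_gt_nhds (show (-1 : ℝ) < 0 by norm_num)] with t ht
    have : y + t • y = (1 + t) • y := by rw [add_smul, one_smul]
    rw [this, norm_smul, Real.norm_of_nonneg (by linarith)]
  rw [(h2.congr_of_eventuallyEq h5.symm).unique h4, mul_comm]

/-- The weak gradient tested against the radial vector field `y ζ(|y|)`. -/
theorem integral_mul_div_radial {N : ℕ} (w : H1 N) {ζ : ℝ → ℝ} (hζ : ContDiff ℝ ∞ ζ)
    (hc : HasCompactSupport ζ) (hs : tsupport ζ ⊆ Set.Ioi 0) :
    ∫ y, fn w y * (N * ζ ‖y‖ + ‖y‖ * deriv ζ ‖y‖) = - ∫ y, ⟪grad w y, y⟫ * ζ ‖y‖ := by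
  set e : Fin N → Space N := fun i => EuclideanSpace.single i (1 : ℝ) with he
  set φ : Fin N → Space N → ℝ := fun i y => y i * ζ ‖y‖ with hφ
  have hcoord : ∀ i, ContDiff ℝ ∞ fun y : Space N => y i := fun i =>
    (EuclideanSpace.proj (𝕜 := ℝ) i).contDiff
  have hsm : ∀ i, ContDiff ℝ ∞ (φ i) := fun i => (hcoord i).mul (contDiff_comp_norm hζ hs)
  have hcs : ∀ i, HasCompactSupport (φ i) := fun i => (hasCompactSupport_comp_norm hc).mul_left
  have hw := fun i => w.2 (φ i) (hsm i) (hcs i) (e i)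
  have hl : ∀ i, Integrable fun y => fn w y * fderiv ℝ (φ i) y (e i) := fun i =>
    integrable_left w.1.fst (hsm i) (hcs i) (e i)
  have hr : ∀ i, Integrable fun y => ⟪grad w y, e i⟫ * φ i y := fun i =>
    integrable_right w.1.snd (hsm i) (hcs i) (e i)
  have hsum : ∑ i, ∫ y, fn w y * fderiv ℝ (φ i) y (e i) =
      ∑ i, - ∫ y, ⟪grad w y, e i⟫ * φ i y := Finset.sum_congr rfl fun i _ => hw i
  rw [Finset.sum_neg_distrib,
    ← integral_finsetSum _ fun i _ => hl i, ← integral_finsetSum _ fun i _ => hr i] at hsum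
  have hexp : ∀ y : Space N, ∑ i, y i • e i = y := fun y => by
    ext j
    simp [he, Finset.sum_apply, Pi.single_apply]
  -- The coordinates y_i ζ(|y|) serve as test functions, each in its own direction; the sum of their
  -- derivatives is the divergence Nζ + |y|ζ' of the field y ζ(|y|).
  have hdiv : ∀ y, fn w y * (N * ζ ‖y‖ + ‖y‖ * deriv ζ ‖y‖)
      = ∑ i, fn w y * fderiv ℝ (φ i) y (e i) := by
    intro y
    rw [← Finset.mul_sum]
    congr 1
    have hfd : ∀ i, fderiv ℝ (φ i) y (e i)
        = y i * fderiv ℝ (fun y : Space N => ζ ‖y‖) y (e i) + ζ ‖y‖ := by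
      intro i
      have h1 : HasFDerivAt (fun y : Space N => y i) (EuclideanSpace.proj (𝕜 := ℝ) i) y :=
        (EuclideanSpace.proj (𝕜 := ℝ) i).hasFDerivAt
      have h2 := ((contDiff_comp_norm (E := Space N) hζ hs).differentiable
        (by simp) y).hasFDerivAt
      have h3 : fderiv ℝ (φ i) y = _ := (h1.mul h2).fderiv
      rw [h3]
      simp [he]
    simp only [hfd, Finset.sum_add_distrib]
    have : ∑ i, y i * fderiv ℝ (fun y : Space N => ζ ‖y‖) y (e i)
        = fderiv ℝ (fun y : Space N => ζ ‖y‖) y y := by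
      conv_rhs => arg 2; rw [← hexp y]
      simp only [map_sum, map_smul, smul_eq_mul]
    rw [this, fderiv_comp_norm_self hζ hs]
    simp [add_comm]
  have hflux : ∀ y, ⟪grad w y, y⟫ * ζ ‖y‖ = ∑ i, ⟪grad w y, e i⟫ * φ i y := by
    intro y
    have : ⟪grad w y, y⟫ = ∑ i, y i * ⟪grad w y, e i⟫ := by
      conv_lhs => arg 3; rw [← hexp y]
      simp only [inner_sum, inner_smul_right]
    rw [this, Finset.sum_mul]
    exact Finset.sum_congr rfl fun i _ => by simp only [hφ]; ring
  simp only [hdiv, hflux]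
  exact hsum

theorem contDiff_inv_pow_mul {χ : ℝ → ℝ} (hχ : ContDiff ℝ ∞ χ) (hs : tsupport χ ⊆ Set.Ioi 0)
    (k : ℕ) : ContDiff ℝ ∞ fun s => (s ^ k)⁻¹ * χ s := by
  rw [contDiff_iff_contDiffAt]
  intro s
  by_cases h : s = 0
  · subst h
    have h0 : (0 : ℝ) ∉ tsupport χ := fun h => lt_irrefl (0 : ℝ) (hs h)
    have h1 : χ =ᶠ[𝓝 0] 0 := notMem_tsupport_iff_eventuallyEq.1 h0
    refine (contDiffAt_const (c := (0 : ℝ))).congr_of_eventuallyEq ?_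
    filter_upwards [h1] with t ht
    simp [ht]
  · exact ((contDiffAt_id.pow k).inv (pow_ne_zero k h)).mul hχ.contDiffAt

theorem tsupport_mul_subset_Ioi {χ : ℝ → ℝ} (hs : tsupport χ ⊆ Set.Ioi 0) (p : ℝ → ℝ) :
    tsupport (fun s => p s * χ s) ⊆ Set.Ioi 0 :=
  (tsupport_mul_subset_right (f := p) (g := χ)).trans hs

/-- The choice ζ(s) = s^{−N} χ(s) makes the divergence Nζ + sζ' collapse to s^{1−N} χ', so no
zeroth-order term remains: this is one-dimensional integration by parts in the radius. -/
theorem integral_mul_deriv_radial {N : ℕ} (hN : 1 ≤ N) (w : H1 N) {χ : ℝ → ℝ}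
    (hχ : ContDiff ℝ ∞ χ) (hc : HasCompactSupport χ) (hs : tsupport χ ⊆ Set.Ioi 0) :
    ∫ y, fn w y * ((‖y‖ ^ (N - 1))⁻¹ * deriv χ ‖y‖)
      = - ∫ y, ⟪grad w y, y⟫ * ((‖y‖ ^ N)⁻¹ * χ ‖y‖) := by
  rw [← integral_mul_div_radial w (contDiff_inv_pow_mul hχ hs N) hc.mul_left
    (tsupport_mul_subset_Ioi hs _)]
  congr 1
  ext y
  congr 1
  by_cases h : ‖y‖ = 0
  · have h0 : (0 : ℝ) ∉ tsupport χ := fun h => lt_irrefl (0 : ℝ) (hs h)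
    have h1 : χ =ᶠ[𝓝 0] 0 := notMem_tsupport_iff_eventuallyEq.1 h0
    have h2 : deriv χ 0 = 0 := by rw [h1.deriv_eq]; simp
    have h3 : χ 0 = 0 := h1.eq_of_nhds
    simp [h, h2, h3]
  · obtain ⟨M, rfl⟩ : ∃ M, N = M + 1 := ⟨N - 1, by omega⟩
    have hd := ((hasDerivAt_pow (M + 1) ‖y‖).fun_inv (pow_ne_zero _ h)).fun_mul
      (hχ.differentiable (by simp) ‖y‖).hasDerivAt
    rw [hd.deriv]
    simp only [Nat.add_sub_cancel]
    field_simp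
    push_cast
    ring

/-- The kernel `b(s) = ∫_{s-1}^s θ(r) (r + 1 - s) dr` and its derivative. -/
theorem exists_averaging_kernel {θ : ℝ → ℝ} (hθ : ContDiff ℝ ∞ θ) (hc : HasCompactSupport θ)
    (hs : tsupport θ ⊆ Set.Ioi 0) :
    ∃ b : ℝ → ℝ, ContDiff ℝ ∞ b ∧ HasCompactSupport b ∧ tsupport b ⊆ Set.Ioi 0 ∧
      (∀ s, b s = ∫ r in (s - 1)..s, θ r * (r + 1 - s)) ∧
      ∀ s, deriv b s = θ s - ∫ r in (s - 1)..s, θ r := by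
  have hi : ∀ a b, IntervalIntegrable θ volume a b := fun a b => hθ.continuous.intervalIntegrable a b
  set Θ : ℝ → ℝ := fun s => ∫ r in (0 : ℝ)..s, θ r with hΘ
  have hΘd : ∀ s, HasDerivAt Θ (θ s) s := fun s => hθ.continuous.integral_hasStrictDerivAt 0 s |>.hasDerivAt
  have hΘs : ContDiff ℝ ∞ Θ := by
    rw [contDiff_infty_iff_deriv]
    refine ⟨fun s => (hΘd s).differentiableAt, ?_⟩
    rwa [show deriv Θ = θ from funext fun s => (hΘd s).deriv]
  set Θ₂ : ℝ → ℝ := fun s => ∫ r in (0 : ℝ)..s, Θ r with hΘ₂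
  have hΘ₂d : ∀ s, HasDerivAt Θ₂ (Θ s) s := fun s =>
    hΘs.continuous.integral_hasStrictDerivAt 0 s |>.hasDerivAt
  have hdiff : ∀ s, ∫ r in (s - 1)..s, θ r = Θ s - Θ (s - 1) := fun s =>
    (intervalIntegral.integral_interval_sub_left (hi _ _) (hi _ _)).symm
  have hdiff₂ : ∀ s, ∫ r in (s - 1)..s, Θ r = Θ₂ s - Θ₂ (s - 1) := fun s =>
    (intervalIntegral.integral_interval_sub_left (hΘs.continuous.intervalIntegrable _ _)
      (hΘs.continuous.intervalIntegrable _ _)).symm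
  -- The announced integral after one integration by parts, with Θ, Θ₂ iterated primitives of θ. In
  -- this form smoothness and the derivative are immediate.
  set b : ℝ → ℝ := fun s => Θ s - (Θ₂ s - Θ₂ (s - 1)) with hb
  have hbd : ∀ s, HasDerivAt b (θ s - (Θ s - Θ (s - 1))) s := fun s => by
    have h := (hΘ₂d (s - 1)).comp s ((hasDerivAt_id s).sub_const 1)
    rw [mul_one] at h
    exact (hΘd s).sub ((hΘ₂d s).sub h)
  have hbi : ∀ s, b s = ∫ r in (s - 1)..s, θ r * (r + 1 - s) := fun s => by
    have hl : ∀ x ∈ Set.uIcc (s - 1) s, HasDerivAt (fun r : ℝ => r + 1 - s) 1 x := fun x _ =>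
      ((hasDerivAt_id x).add_const 1).sub_const s
    have h := intervalIntegral.integral_mul_deriv_eq_deriv_mul (u := fun r : ℝ => r + 1 - s)
      (v := Θ) (u' := fun _ => 1) (v' := θ) (a := s - 1) (b := s) hl (fun x _ => hΘd x)
      intervalIntegrable_const (hi _ _)
    simp only [one_mul, hdiff₂] at h
    simp only [hb, mul_comm (θ _)]
    rw [h]
    ring
  have hbs : ContDiff ℝ ∞ b := by
    rw [contDiff_infty_iff_deriv]
    refine ⟨fun s => (hbd s).differentiableAt, ?_⟩
    rw [show deriv b = _ from funext fun s => (hbd s).deriv]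
    exact hθ.sub (hΘs.sub (hΘs.comp (contDiff_id.sub contDiff_const)))
  obtain ⟨α, hα, β, hαβ⟩ : ∃ α > 0, ∃ β, tsupport θ ⊆ Set.Icc α β := by
    rcases (tsupport θ).eq_empty_or_nonempty with h | h
    · exact ⟨1, one_pos, 1, by simp [h]⟩
    · obtain ⟨α, hα⟩ := hc.isCompact.exists_isLeast h
      obtain ⟨β, hβ⟩ := hc.isCompact.exists_isGreatest h
      exact ⟨α, hs hα.1, β, fun x hx => ⟨hα.2 hx, hβ.2 hx⟩⟩
  -- The window [s − 1, s] meets [α, β] only if α ≤ s ≤ β + 1; in particular the support stays away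
  -- from 0.
  have hsub : tsupport b ⊆ Set.Icc α (β + 1) := by
    refine closure_minimal (fun s h => ?_) isClosed_Icc
    by_contra hn
    refine h ?_
    rw [hbi, intervalIntegral.integral_of_le (by linarith)]
    refine setIntegral_eq_zero_of_forall_eq_zero fun r hr => ?_
    have : r ∉ Set.Icc α β := fun hr' => hn ⟨hr'.1.trans hr.2, by linarith [hr.1, hr'.2]⟩
    rw [image_eq_zero_of_notMem_tsupport fun h => this (hαβ h), zero_mul]
  refine ⟨b, hbs, HasCompactSupport.of_support_subset_isCompact isCompact_Icc
    ((subset_tsupport b).trans hsub), hsub.trans fun x hx => hα.trans_le hx.1, hbi, fun s => ?_⟩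
  rw [(hbd s).deriv, hdiff]

/-! ### Integration of radial functions in polar coordinates. -/

/-- The surface area of the unit sphere of `ℝ^N`. -/
noncomputable def sphereArea (N : ℕ) : ℝ := N * volume.real (Metric.ball (0 : Space N) 1)

theorem sphereArea_pos {N : ℕ} (hN : 1 ≤ N) : 0 < sphereArea N := by
  have : 0 < volume.real (Metric.ball (0 : Space N) 1) :=
    ENNReal.toReal_pos (Metric.measure_ball_pos _ _ one_pos).ne' measure_ball_lt_top.ne
  unfold sphereArea
  positivity

theorem integral_comp_norm {N : ℕ} (hN : 1 ≤ N) (F : ℝ → ℝ) :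
    ∫ x : Space N, F ‖x‖ = sphereArea N * ∫ s in Set.Ioi (0 : ℝ), s ^ (N - 1) * F s := by
  have : Nonempty (Fin N) := ⟨⟨0, hN⟩⟩
  rw [integral_fun_norm_addHaar]
  simp [sphereArea, mul_assoc]

theorem integrable_comp_norm_iff {N : ℕ} (hN : 1 ≤ N) (F : ℝ → ℝ) :
    Integrable (fun x : Space N => F ‖x‖) ↔
      IntegrableOn (fun s => s ^ (N - 1) * F s) (Set.Ioi 0) := by
  have : Nonempty (Fin N) := ⟨⟨0, hN⟩⟩
  rw [integrable_fun_norm_addHaar]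
  simp

/-- The indicator of the exceptional radii has integral zero in polar coordinates. Measurability of
`P` is not needed, because that indicator is almost everywhere zero on the half-line. -/
theorem ae_comp_norm {N : ℕ} (hN : 1 ≤ N) {P : ℝ → Prop}
    (h : ∀ᵐ s ∂(volume.restrict (Set.Ioi (0 : ℝ))), P s) : ∀ᵐ x : Space N, P ‖x‖ := by
  classical
  set F : ℝ → ℝ := fun s => if P s then 0 else 1 with hF
  have h0 : (fun s => s ^ (N - 1) * F s) =ᵐ[volume.restrict (Set.Ioi (0 : ℝ))] 0 := by
    filter_upwards [h] with s hs
    simp [hF, hs]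
  have hi : Integrable (fun x : Space N => F ‖x‖) :=
    (integrable_comp_norm_iff hN F).2 ((integrable_congr h0).2 (integrable_zero _ _ _))
  have hz : ∫ x : Space N, F ‖x‖ = 0 := by
    rw [integral_comp_norm hN, integral_congr_ae h0]
    simp
  have hnn : 0 ≤ fun x : Space N => F ‖x‖ := fun x => by
    simp only [hF, Pi.zero_apply]; split_ifs <;> norm_num
  have := (integral_eq_zero_iff_of_nonneg hnn hi).1 hz
  filter_upwards [this] with x hx
  by_contra hP
  simp [hF, hP] at hx

/-! ### The reproducing kernel of radial functions. -/

/-- The scalar part of the kernel that represents the value at radius `r`. -/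
noncomputable def kernel₁ {N : ℕ} (r : ℝ) (y : Space N) : ℝ :=
  (Set.Ioc r (r + 1)).indicator (fun s => (s ^ (N - 1))⁻¹) ‖y‖

/-- The vector part of the kernel that represents the value at radius `r`. -/
noncomputable def kernel₂ {N : ℕ} (r : ℝ) (y : Space N) : Space N :=
  (-(Set.Ioc r (r + 1)).indicator (fun s => (r + 1 - s) * (s ^ N)⁻¹) ‖y‖) • y

theorem kernel₁_nonneg {N : ℕ} (r : ℝ) (y : Space N) : 0 ≤ kernel₁ r y :=
  Set.indicator_apply_nonneg fun _ => by positivity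

/-- On the shell 0 ≤ r + 1 − |y| ≤ 1, and the factor y cancels one power of |y|. One scalar kernel
therefore controls both components. -/
theorem norm_kernel₂_le {N : ℕ} (hN : 1 ≤ N) {r : ℝ} (hr : 0 ≤ r) (y : Space N) :
    ‖kernel₂ r y‖ ≤ kernel₁ r y := by
  unfold kernel₁ kernel₂
  by_cases h : ‖y‖ ∈ Set.Ioc r (r + 1)
  · rw [Set.indicator_of_mem h, Set.indicator_of_mem h, norm_smul, norm_neg, norm_mul, norm_inv,
      norm_pow, norm_norm, Real.norm_of_nonneg (by linarith [h.2])]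
    have hy : 0 < ‖y‖ := hr.trans_lt h.1
    obtain ⟨M, rfl⟩ : ∃ M, N = M + 1 := ⟨N - 1, by omega⟩
    simp only [Nat.add_sub_cancel]
    rw [show (r + 1 - ‖y‖) * (‖y‖ ^ (M + 1))⁻¹ * ‖y‖ = (r + 1 - ‖y‖) * (‖y‖ ^ M)⁻¹ by
      field_simp; ring]
    exact mul_le_of_le_one_left (by positivity) (by linarith [h.1])
  · simp [h]

theorem measurable_kernel₁ {N : ℕ} :
    Measurable fun p : ℝ × Space N => kernel₁ p.1 p.2 := by
  have : (fun p : ℝ × Space N => kernel₁ p.1 p.2) =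
      {p : ℝ × Space N | p.1 < ‖p.2‖ ∧ ‖p.2‖ ≤ p.1 + 1}.indicator
        fun p => (‖p.2‖ ^ (N - 1))⁻¹ := by
    ext p
    simp [kernel₁, Set.indicator_apply, Set.mem_Ioc]
  rw [this]
  refine Measurable.indicator (by fun_prop) ?_
  exact (measurableSet_lt measurable_fst measurable_snd.norm).inter
    (measurableSet_le measurable_snd.norm (measurable_fst.add_const 1))

theorem measurable_kernel₂ {N : ℕ} :
    Measurable fun p : ℝ × Space N => kernel₂ p.1 p.2 := by
  have : (fun p : ℝ × Space N => kernel₂ p.1 p.2) =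
      {p : ℝ × Space N | p.1 < ‖p.2‖ ∧ ‖p.2‖ ≤ p.1 + 1}.indicator
        fun p => (-((p.1 + 1 - ‖p.2‖) * (‖p.2‖ ^ N)⁻¹)) • p.2 := by
    ext p
    simp only [kernel₂, Set.indicator_apply, Set.mem_Ioc, Set.mem_ofPred_eq]
    split_ifs <;> simp
  rw [this]
  refine Measurable.indicator (by fun_prop) ?_
  exact (measurableSet_lt measurable_fst measurable_snd.norm).inter
    (measurableSet_le measurable_snd.norm (measurable_fst.add_const 1))

/-- A majorant that is uniform for r in a compact subset of the open half-line, as Fubini's theorem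
requires. -/
theorem kernel₁_le {N : ℕ} {α β r : ℝ} (hα : 0 < α) (hr : r ∈ Set.Icc α β) (y : Space N) :
    kernel₁ r y ≤ (Metric.closedBall (0 : Space N) (β + 1)).indicator
      (fun _ => (α ^ (N - 1))⁻¹) y := by
  unfold kernel₁
  by_cases h : ‖y‖ ∈ Set.Ioc r (r + 1)
  · rw [Set.indicator_of_mem h, Set.indicator_of_mem (by simpa using h.2.trans (by linarith [hr.2]))]
    have : α ≤ ‖y‖ := hr.1.trans h.1.le
    gcongr
  · rw [Set.indicator_of_notMem h]
    exact Set.indicator_apply_nonneg fun _ => by positivity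

theorem memLp_kernel₁ {N : ℕ} {r : ℝ} (hr : 0 < r) :
    MemLp (kernel₁ r : Space N → ℝ) 2 volume := by
  refine MemLp.mono (g := (Metric.closedBall (0 : Space N) (r + 1)).indicator
      (fun _ => (r ^ (N - 1))⁻¹)) ?_
    (measurable_kernel₁.comp measurable_prodMk_left).aestronglyMeasurable (.of_forall fun y => ?_)
  · exact memLp_indicator_const _ measurableSet_closedBall _ (.inr measure_closedBall_lt_top.ne)
  · have := kernel₁_le hr (Set.left_mem_Icc.2 le_rfl) y
    rw [Real.norm_of_nonneg (kernel₁_nonneg r y)]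
    exact this.trans (le_abs_self _)

theorem memLp_kernel₂ {N : ℕ} (hN : 1 ≤ N) {r : ℝ} (hr : 0 < r) :
    MemLp (kernel₂ r : Space N → Space N) 2 volume :=
  (memLp_kernel₁ hr).mono (measurable_kernel₂.comp measurable_prodMk_left).aestronglyMeasurable
    (.of_forall fun y => (norm_kernel₂_le hN hr.le y).trans (le_abs_self _))

theorem memLp_fn {N : ℕ} (w : H1 N) : MemLp (fn w) 2 volume := Lp.memLp w.1.fst

theorem memLp_grad {N : ℕ} (w : H1 N) : MemLp (grad w) 2 volume := Lp.memLp w.1.snd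

/-- The radial average that reproduces a radial function. -/
noncomputable def radialMean {N : ℕ} (w : H1 N) (r : ℝ) : ℝ :=
  ∫ y, (fn w y * kernel₁ r y + ⟪grad w y, kernel₂ r y⟫)

theorem abs_integrand_le {N : ℕ} (hN : 1 ≤ N) (w : H1 N) {r : ℝ} (hr : 0 ≤ r) (y : Space N) :
    |fn w y * kernel₁ r y + ⟪grad w y, kernel₂ r y⟫| ≤ (|fn w y| + ‖grad w y‖) * kernel₁ r y := by
  refine (abs_add_le _ _).trans ?_
  rw [add_mul, abs_mul, abs_of_nonneg (kernel₁_nonneg r y)]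
  gcongr
  exact (abs_real_inner_le_norm _ _).trans (by gcongr; exact norm_kernel₂_le hN hr y)

/-- θ is merely integrable here: the lemma serves both smooth test functions and the indicator of
[α, β], the latter giving local integrability of `radialMean`. -/
theorem integrable_prod_kernel {N : ℕ} (hN : 1 ≤ N) (w : H1 N) {α β : ℝ} (hα : 0 < α)
    {θ : ℝ → ℝ} (hθ : Integrable θ) (hs : ∀ r ∉ Set.Icc α β, θ r = 0) :
    Integrable (fun p : ℝ × Space N =>
      θ p.1 * (fn w p.2 * kernel₁ p.1 p.2 + ⟪grad w p.2, kernel₂ p.1 p.2⟫))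
      (volume.prod volume) := by
  set H : Space N → ℝ := fun y => (|fn w y| + ‖grad w y‖) *
    (Metric.closedBall (0 : Space N) (β + 1)).indicator (fun _ => (α ^ (N - 1))⁻¹) y with hH
  have hHi : Integrable H := by
    have h1 : MemLp (fun y => |fn w y| + ‖grad w y‖) 2 volume :=
      (memLp_fn w).norm.add (memLp_grad w).norm
    have h2 : MemLp ((Metric.closedBall (0 : Space N) (β + 1)).indicator
        (fun _ => (α ^ (N - 1))⁻¹)) 2 volume :=
      memLp_indicator_const _ measurableSet_closedBall _ (.inr measure_closedBall_lt_top.ne)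
    exact h1.integrable_mul (q := 2) h2
  refine (hθ.mul_prod hHi).mono ?_ (.of_forall fun p => ?_)
  · refine hθ.aestronglyMeasurable.comp_fst.mul (.add ?_ ?_)
    · exact (memLp_fn w).1.comp_snd.mul measurable_kernel₁.aestronglyMeasurable
    · exact (memLp_grad w).1.comp_snd.inner measurable_kernel₂.aestronglyMeasurable
  · by_cases hp : p.1 ∈ Set.Icc α β
    · rw [norm_mul, norm_mul]
      gcongr
      rw [Real.norm_eq_abs]
      refine (abs_integrand_le hN w (hα.le.trans hp.1) p.2).trans (le_trans ?_ (le_abs_self _))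
      simp only [hH]
      gcongr
      exact kernel₁_le hα hp p.2
    · simp [hs _ hp]

/-- The reproducing formula in weak form. By Fubini the r-integral falls on the kernels: at |y| = s
it turns `kernel₁` into s^{1−N} (θ(s) − b'(s)) and the coefficient of y in `kernel₂` into −s^{−N}
b(s), where b is the averaging kernel of θ. The terms with b cancel by `integral_mul_deriv_radial`
with χ = b. -/
theorem integral_mul_radialMean {N : ℕ} (hN : 1 ≤ N) (w : H1 N) {θ : ℝ → ℝ}
    (hθ : ContDiff ℝ ∞ θ) (hc : HasCompactSupport θ) (hs : tsupport θ ⊆ Set.Ioi 0) :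
    ∫ r, θ r * radialMean w r = ∫ y, fn w y * ((‖y‖ ^ (N - 1))⁻¹ * θ ‖y‖) := by
  obtain ⟨α, hα, β, hαβ⟩ : ∃ α > 0, ∃ β, tsupport θ ⊆ Set.Icc α β := by
    rcases (tsupport θ).eq_empty_or_nonempty with h | h
    · exact ⟨1, one_pos, 1, by simp [h]⟩
    · obtain ⟨α, hα⟩ := hc.isCompact.exists_isLeast h
      obtain ⟨β, hβ⟩ := hc.isCompact.exists_isGreatest h
      exact ⟨α, hs hα.1, β, fun x hx => ⟨hα.2 hx, hβ.2 hx⟩⟩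
  obtain ⟨b, hb, hbc, hbs, hbi, hbd⟩ := exists_averaging_kernel hθ hc hs
  have hint := integrable_prod_kernel hN w hα (hθ.continuous.integrable_of_hasCompactSupport hc)
    (β := β) fun r hr => image_eq_zero_of_notMem_tsupport fun h => hr (hαβ h)
  simp only [radialMean, ← integral_const_mul]
  rw [integral_integral_swap hint]
  have hmem : ∀ s r : ℝ, s ∈ Set.Ioc r (r + 1) ↔ r ∈ Set.Ico (s - 1) s := fun s r => by
    simp only [Set.mem_Ioc, Set.mem_Ico]; constructor <;> rintro ⟨h1, h2⟩ <;> constructor <;> linarith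
  have hIco : ∀ (p : ℝ → ℝ) (s : ℝ), ∫ r in Set.Ico (s - 1) s, p r = ∫ r in (s - 1)..s, p r :=
    fun p s => by
      rw [intervalIntegral.integral_of_le (by linarith), integral_Ico_eq_integral_Ioo,
        integral_Ioc_eq_integral_Ioo]
  have hcont : Continuous θ := hθ.continuous
  have key : ∀ y : Space N,
      ∫ r, θ r * (fn w y * kernel₁ r y + ⟪grad w y, kernel₂ r y⟫)
        = fn w y * ((‖y‖ ^ (N - 1))⁻¹ * θ ‖y‖) - (fn w y * ((‖y‖ ^ (N - 1))⁻¹ * deriv b ‖y‖)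
          + ⟪grad w y, y⟫ * ((‖y‖ ^ N)⁻¹ * b ‖y‖)) := by
    intro y
    have e : (fun r => θ r * (fn w y * kernel₁ r y + ⟪grad w y, kernel₂ r y⟫)) =
        (Set.Ico (‖y‖ - 1) ‖y‖).indicator fun r =>
          (fn w y * (‖y‖ ^ (N - 1))⁻¹) * θ r
            - (⟪grad w y, y⟫ * (‖y‖ ^ N)⁻¹) * (θ r * (r + 1 - ‖y‖)) := by
      ext r
      simp only [kernel₁, kernel₂, Set.indicator_apply, hmem]
      split_ifs
      · rw [inner_smul_right]; ring
      · simp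
    rw [e, integral_indicator measurableSet_Ico, integral_sub, integral_const_mul,
      integral_const_mul, hIco, hIco, ← hbi, hbd]
    · ring
    · exact ((by fun_prop : Continuous fun r => (fn w y * (‖y‖ ^ (N - 1))⁻¹) * θ r).integrableOn_Icc
        (a := ‖y‖ - 1) (b := ‖y‖)).mono_set Set.Ico_subset_Icc_self
    · exact ((by fun_prop : Continuous fun r =>
        (⟪grad w y, y⟫ * (‖y‖ ^ N)⁻¹) * (θ r * (r + 1 - ‖y‖))).integrableOn_Icc
        (a := ‖y‖ - 1) (b := ‖y‖)).mono_set Set.Ico_subset_Icc_self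
  have hI : ∀ {χ : ℝ → ℝ}, ContDiff ℝ ∞ χ → HasCompactSupport χ → tsupport χ ⊆ Set.Ioi 0 → ∀ k : ℕ,
      MemLp (fun y : Space N => (‖y‖ ^ k)⁻¹ * χ ‖y‖) 2 volume := fun h1 h2 h3 k =>
    (contDiff_comp_norm (E := Space N) (contDiff_inv_pow_mul h1 h3 k)
      (tsupport_mul_subset_Ioi h3 _)).continuous.memLp_of_hasCompactSupport
      (hasCompactSupport_comp_norm (E := Space N) (h2.mul_left (f := fun s => (s ^ k)⁻¹)))
  have hb' : ContDiff ℝ ∞ (deriv b) := (contDiff_infty_iff_deriv.1 hb).2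
  have i1 : Integrable fun y => fn w y * ((‖y‖ ^ (N - 1))⁻¹ * θ ‖y‖) :=
    (memLp_fn w).integrable_mul (q := 2) (hI hθ hc hs _)
  have i2 : Integrable fun y => fn w y * ((‖y‖ ^ (N - 1))⁻¹ * deriv b ‖y‖) :=
    (memLp_fn w).integrable_mul (q := 2) (hI hb' hbc.deriv ((tsupport_deriv_subset).trans hbs) _)
  have i3 : Integrable fun y => ⟪grad w y, y⟫ * ((‖y‖ ^ N)⁻¹ * b ‖y‖) := by
    refine Integrable.mono ((memLp_grad w).norm.integrable_mul (q := 2)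
      (hI (contDiff_id.mul hb) hbc.mul_left (tsupport_mul_subset_Ioi hbs _) N)) ?_
      (.of_forall fun y => ?_)
    · have : Continuous b := hb.continuous
      exact ((memLp_grad w).1.inner aestronglyMeasurable_id).mul
        (by fun_prop : Measurable fun y : Space N => (‖y‖ ^ N)⁻¹ * b ‖y‖).aestronglyMeasurable
    · simp only [norm_mul, Pi.mul_apply, id, norm_norm]
      calc _ ≤ ‖grad w y‖ * ‖y‖ * (‖(‖y‖ ^ N)⁻¹‖ * ‖b ‖y‖‖) := by
            gcongr; exact norm_inner_le_norm _ _
        _ = _ := by ring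
  simp only [key]
  rw [integral_sub i1 (by exact i2.add i3), integral_add i2 i3, integral_mul_deriv_radial hN w hb hbc hbs]
  ring

/-- `w` is almost everywhere a function of `|x|`. -/
def IsRadial {N : ℕ} (w : H1 N) : Prop := ∃ ρ : ℝ → ℝ, fn w =ᵐ[volume] fun x => ρ ‖x‖

/-- The norm of `H¹(ℝ^N)`. -/
noncomputable def h1Norm {N : ℕ} (w : H1 N) : ℝ := ‖w‖

theorem h1Norm_nonneg {N : ℕ} (w : H1 N) : 0 ≤ h1Norm w := norm_nonneg w

/-- In polar coordinates `integral_mul_radialMean` says that the profile, times the sphere area, and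
`radialMean` have the same integral against every test function on (0, ∞). The fundamental lemma of
the calculus of variations then identifies them. -/
theorem ae_eq_radialMean {N : ℕ} (hN : 1 ≤ N) {w : H1 N} (hw : IsRadial w) :
    ∀ᵐ x, sphereArea N * fn w x = radialMean w ‖x‖ := by
  obtain ⟨ρ, hρ⟩ := hw
  -- The profile ρ is not assumed measurable. Its integrability on [α, β] is read off from that of
  -- the function on the corresponding shell.
  have hρi : ∀ α β : ℝ, 0 < α → IntegrableOn ρ (Set.Icc α β) := by
    intro α β hα
    have h1 : MemLp ((Metric.closedBall (0 : Space N) β \ Metric.ball 0 α).indicator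
        (fun _ => (1 : ℝ))) 2 volume :=
      memLp_indicator_const _ (measurableSet_closedBall.diff measurableSet_ball) _
        (.inr ((measure_mono Set.sdiff_subset).trans_lt measure_closedBall_lt_top).ne)
    have h2 := (memLp_fn w).integrable_mul (q := 2) h1
    have h3 : Integrable fun x : Space N => (Set.Icc α β).indicator ρ ‖x‖ := by
      refine h2.congr ?_
      filter_upwards [hρ] with x hx
      have hmem : x ∈ Metric.closedBall (0 : Space N) β \ Metric.ball 0 α ↔ ‖x‖ ∈ Set.Icc α β := by
        simp [and_comm]
      by_cases h : ‖x‖ ∈ Set.Icc α β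
      · simp [Set.indicator_of_mem h, Set.indicator_of_mem (hmem.2 h), hx]
      · simp [Set.indicator_of_notMem h, Set.indicator_of_notMem (mt hmem.1 h)]
    have h4 := (integrable_comp_norm_iff hN _).1 h3
    have h5 : IntegrableOn (fun s : ℝ => (s ^ (N - 1))⁻¹ * (s ^ (N - 1) * ρ s)) (Set.Icc α β) := by
      have h6 : IntegrableOn (fun s : ℝ => s ^ (N - 1) * ρ s) (Set.Icc α β) := by
        refine (h4.mono_set (fun s hs => hα.trans_le hs.1)).congr_fun (fun s hs => ?_)
          measurableSet_Icc
        simp [Set.indicator_of_mem hs]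
      refine IntegrableOn.continuousOn_mul ?_ h6 isCompact_Icc
      exact ContinuousOn.inv₀ (by fun_prop) fun s hs => pow_ne_zero _ (hα.trans_le hs.1).ne'
    refine h5.congr_fun (fun s hs => ?_) measurableSet_Icc
    have : s ^ (N - 1) ≠ 0 := pow_ne_zero _ (hα.trans_le hs.1).ne'
    simp only
    field_simp
  have hmi : ∀ α β : ℝ, 0 < α → IntegrableOn (radialMean w) (Set.Icc α β) := by
    intro α β hα
    have h := (integrable_prod_kernel hN w (β := β) hα
      (θ := (Set.Icc α β).indicator fun _ => 1)
      ((integrable_indicator_iff measurableSet_Icc).2 (by simp))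
      fun r hr => Set.indicator_of_notMem hr _).integral_prod_left
    simp only [integral_const_mul] at h
    rw [← integrable_indicator_iff measurableSet_Icc]
    refine h.congr (.of_forall fun r => ?_)
    by_cases hr : r ∈ Set.Icc α β <;> simp [hr, radialMean]
  have hloc : LocallyIntegrableOn (fun s => sphereArea N * ρ s - radialMean w s)
      (Set.Ioi 0) := by
    intro s hs
    refine ⟨Set.Icc (s / 2) (2 * s), mem_nhdsWithin_of_mem_nhds (Icc_mem_nhds ?_ ?_), ?_⟩
    · linarith [Set.mem_Ioi.1 hs]
    · linarith [Set.mem_Ioi.1 hs]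
    · have : 0 < s / 2 := half_pos hs
      exact ((hρi _ _ this).const_mul _).sub (hmi _ _ this)
  have hae := isOpen_Ioi.ae_eq_zero_of_integral_contDiff_smul_eq_zero hloc
    (fun θ hθ hc hs => by
      obtain ⟨α, hα, β, hαβ⟩ : ∃ α > 0, ∃ β, tsupport θ ⊆ Set.Icc α β := by
        rcases (tsupport θ).eq_empty_or_nonempty with h | h
        · exact ⟨1, one_pos, 1, by simp [h]⟩
        · obtain ⟨α, hα⟩ := hc.isCompact.exists_isLeast h
          obtain ⟨β, hβ⟩ := hc.isCompact.exists_isGreatest h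
          exact ⟨α, hs hα.1, β, fun x hx => ⟨hα.2 hx, hβ.2 hx⟩⟩
      have hmul : ∀ p : ℝ → ℝ, IntegrableOn p (Set.Icc α β) → Integrable fun s => θ s * p s := by
        intro p hp
        have h1 : IntegrableOn (fun s => θ s * p s) (Set.Icc α β) :=
          IntegrableOn.continuousOn_mul hθ.continuous.continuousOn hp isCompact_Icc
        rw [← integrable_indicator_iff measurableSet_Icc] at h1
        refine h1.congr (.of_forall fun s => ?_)
        by_cases hs' : s ∈ Set.Icc α β
        · simp [hs']
        · simp [hs', image_eq_zero_of_notMem_tsupport fun h => hs' (hαβ h)]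
      have e : ∫ y, fn w y * ((‖y‖ ^ (N - 1))⁻¹ * θ ‖y‖)
          = ∫ y : Space N, ρ ‖y‖ * ((‖y‖ ^ (N - 1))⁻¹ * θ ‖y‖) := by
        refine integral_congr_ae ?_
        filter_upwards [hρ] with x hx
        rw [hx]
      have e2 : ∫ s in Set.Ioi (0 : ℝ), s ^ (N - 1) * (ρ s * ((s ^ (N - 1))⁻¹ * θ s))
          = ∫ s, θ s * ρ s := by
        rw [← setIntegral_eq_integral_of_forall_compl_eq_zero (s := Set.Ioi (0 : ℝ))
          (f := fun s => θ s * ρ s) fun s hs' => by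
            rw [image_eq_zero_of_notMem_tsupport fun h => hs' (hs h), zero_mul]]
        refine setIntegral_congr_fun measurableSet_Ioi fun s hs => ?_
        have : s ^ (N - 1) ≠ 0 := pow_ne_zero _ (Set.mem_Ioi.1 hs).ne'
        field_simp
      simp only [smul_eq_mul, mul_sub]
      have i1 : Integrable fun s => θ s * (sphereArea N * ρ s) := by
        simpa only [mul_left_comm] using (hmul ρ (hρi α β hα)).const_mul (sphereArea N)
      rw [integral_sub i1 (hmul _ (hmi α β hα)), integral_mul_radialMean hN _ hθ hc hs, e,
        integral_comp_norm hN (fun s => ρ s * ((s ^ (N - 1))⁻¹ * θ s)), e2,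
        ← integral_const_mul, sub_eq_zero]
      congr 1
      ext s
      ring)
  have h := ae_comp_norm hN ((ae_restrict_iff' measurableSet_Ioi).2 hae)
  filter_upwards [h, hρ] with x hx hx'
  rw [hx']
  linarith

/-! ### Pointwise bounds for radial functions. -/

/-- `∫_r^{r+1} s^{1-N} ds`. -/
noncomputable def shellIntegral (N : ℕ) (r : ℝ) : ℝ := ∫ s in Set.Ioc r (r + 1), (s ^ (N - 1))⁻¹

theorem integrableOn_inv_pow {r : ℝ} (hr : 0 < r) (k : ℕ) :
    IntegrableOn (fun s : ℝ => (s ^ k)⁻¹) (Set.Ioc r (r + 1)) := by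
  refine (ContinuousOn.integrableOn_Icc ?_).mono_set Set.Ioc_subset_Icc_self
  exact ContinuousOn.inv₀ (by fun_prop) fun s hs => pow_ne_zero _ (hr.trans_le hs.1).ne'

theorem shellIntegral_nonneg (N : ℕ) {r : ℝ} (hr : 0 < r) : 0 ≤ shellIntegral N r :=
  setIntegral_nonneg measurableSet_Ioc fun s hs => by
    have : 0 < s := hr.trans hs.1
    positivity

/-- The Jacobian s^{N−1} cancels one of the two factors s^{1−N}. -/
theorem integral_kernel₁_sq {N : ℕ} (hN : 1 ≤ N) {r : ℝ} (hr : 0 < r) :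
    ∫ y : Space N, kernel₁ r y ^ 2 = sphereArea N * shellIntegral N r := by
  have h := integral_comp_norm hN
    fun s => (Set.Ioc r (r + 1)).indicator (fun s => (s ^ (N - 1))⁻¹) s ^ 2
  refine h.trans ?_
  rw [shellIntegral, ← integral_indicator measurableSet_Ioc, ← integral_indicator measurableSet_Ioi]
  congr 2
  ext s
  by_cases h : s ∈ Set.Ioc r (r + 1)
  · have hs : 0 < s := hr.trans h.1
    rw [Set.indicator_of_mem (Set.mem_Ioi.2 hs)]
    simp only [Set.indicator_of_mem h]
    field_simp
  · by_cases h' : s ∈ Set.Ioi (0 : ℝ) <;> simp [h, h']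

theorem h1Norm_sq {N : ℕ} (w : H1 N) : h1Norm w ^ 2 = ‖w.1.fst‖ ^ 2 + ‖w.1.snd‖ ^ 2 :=
  WithLp.prod_norm_sq_eq_of_L2 w.1

theorem norm_fst_sq {N : ℕ} (w : H1 N) : ‖w.1.fst‖ ^ 2 = ∫ x, fn w x ^ 2 := by
  rw [← real_inner_self_eq_norm_sq, L2.inner_def]
  congr 1
  ext x
  simp [fn, sq]

theorem norm_snd_sq {N : ℕ} (w : H1 N) : ‖w.1.snd‖ ^ 2 = ∫ x, ‖grad w x‖ ^ 2 := by
  rw [← real_inner_self_eq_norm_sq, L2.inner_def]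
  congr 1
  ext x
  rw [real_inner_self_eq_norm_sq]
  rfl

/-- Radial averages are represented by an element of the ambient Hilbert space. -/
theorem exists_radialMean_eq_inner {N : ℕ} (hN : 1 ≤ N) {r : ℝ} (hr : 0 < r) :
    ∃ κ : WithLp 2 (Lp ℝ 2 (volume : Measure (Space N)) ×
      Lp (Space N) 2 (volume : Measure (Space N))),
      ‖κ‖ ^ 2 ≤ 2 * (sphereArea N * shellIntegral N r) ∧
        ∀ w : H1 N, radialMean w r = ⟪κ, w.1⟫ := by
  have m1 := memLp_kernel₁ (N := N) hr
  have m2 := memLp_kernel₂ hN hr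
  refine ⟨WithLp.toLp 2 (m1.toLp _, m2.toLp _), ?_, fun w => ?_⟩
  -- The factor 2 counts the two components, each of norm at most that of `kernel₁`.
  · rw [WithLp.prod_norm_sq_eq_of_L2, ← integral_kernel₁_sq hN hr, two_mul]
    have e1 : ‖m1.toLp _‖ ^ 2 = ∫ y : Space N, kernel₁ r y ^ 2 := by
      rw [← real_inner_self_eq_norm_sq, L2.inner_def]
      refine integral_congr_ae ?_
      filter_upwards [m1.coeFn_toLp] with y hy
      simp [hy, sq]
    have e2 : ‖m2.toLp _‖ ^ 2 = ∫ y : Space N, ‖kernel₂ r y‖ ^ 2 := by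
      rw [← real_inner_self_eq_norm_sq, L2.inner_def]
      refine integral_congr_ae ?_
      filter_upwards [m2.coeFn_toLp] with y hy
      rw [hy, real_inner_self_eq_norm_sq]
    refine add_le_add e1.le (e2.le.trans (integral_mono ?_ ?_ fun y => ?_))
    · exact (memLp_two_iff_integrable_sq_norm m2.1).1 m2
    · exact (memLp_two_iff_integrable_sq m1.1).1 m1
    · have := norm_kernel₂_le hN hr.le y
      dsimp only
      gcongr
  · rw [WithLp.prod_inner_apply, L2.inner_def, L2.inner_def, radialMean, integral_add]
    · congr 1
      · refine integral_congr_ae ?_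
        filter_upwards [m1.coeFn_toLp] with y hy
        simp [hy, fn]
      · refine integral_congr_ae ?_
        filter_upwards [m2.coeFn_toLp] with y hy
        simp only [hy]
        exact real_inner_comm _ _
    · exact (memLp_fn w).integrable_mul (q := 2) m1
    · exact ((memLp_grad w).norm.integrable_mul (q := 2) m2.norm).mono
        ((memLp_grad w).1.inner m2.1) (.of_forall fun y => by
          simpa using abs_real_inner_le_norm (grad w y) (kernel₂ r y))

/-- The growth rate of radial `H¹` functions. -/
noncomputable def radialBound (N : ℕ) (r : ℝ) : ℝ :=
  Real.sqrt (2 / sphereArea N * shellIntegral N r)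

theorem radialBound_nonneg (N : ℕ) (r : ℝ) : 0 ≤ radialBound N r := Real.sqrt_nonneg _

theorem radialBound_sq {N : ℕ} (hN : 1 ≤ N) {r : ℝ} (hr : 0 < r) :
    radialBound N r ^ 2 = 2 / sphereArea N * shellIntegral N r :=
  Real.sq_sqrt (mul_nonneg (by have := sphereArea_pos hN; positivity) (shellIntegral_nonneg N hr))

theorem ae_norm_pos {N : ℕ} (hN : 1 ≤ N) : ∀ᵐ x : Space N, 0 < ‖x‖ :=
  ae_comp_norm hN (P := fun s => 0 < s) (ae_restrict_mem measurableSet_Ioi)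

theorem abs_le_sqrt_mul {σ J u k t : ℝ} (hσ : 0 < σ) (ht : 0 ≤ t) (h1 : |σ * u| ≤ k * t)
    (hk : k ^ 2 ≤ 2 * (σ * J)) : |u| ≤ Real.sqrt (2 / σ * J) * t := by
  have hJ : 0 ≤ J := by
    by_contra! h
    have := mul_neg_of_pos_of_neg hσ h
    linarith [sq_nonneg k]
  refine abs_le_of_sq_le_sq ?_ (mul_nonneg (Real.sqrt_nonneg _) ht)
  rw [mul_pow, Real.sq_sqrt (by positivity)]
  have h2 : (σ * u) ^ 2 ≤ 2 * (σ * J) * t ^ 2 := by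
    rw [← sq_abs]
    calc _ ≤ (k * t) ^ 2 := by gcongr
      _ = k ^ 2 * t ^ 2 := by ring
      _ ≤ _ := by gcongr
  have h3 : 2 / σ * J * t ^ 2 = (2 * (σ * J) * t ^ 2) / σ ^ 2 := by field_simp
  rw [h3, le_div_iff₀ (by positivity)]
  linarith [mul_pow σ u 2]

/-- Pointwise bound for radial functions. -/
theorem ae_abs_fn_le {N : ℕ} (hN : 1 ≤ N) {w : H1 N} (hw : IsRadial w) :
    ∀ᵐ x, |fn w x| ≤ radialBound N ‖x‖ * h1Norm w := by
  filter_upwards [ae_eq_radialMean hN hw, ae_norm_pos hN] with x hx hx0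
  obtain ⟨κ, hκ, hκw⟩ := exists_radialMean_eq_inner hN hx0
  have h1 : |sphereArea N * fn w x| ≤ ‖κ‖ * h1Norm w := by
    rw [hx, hκw]
    exact abs_real_inner_le_norm κ w.1
  exact abs_le_sqrt_mul (sphereArea_pos hN) (h1Norm_nonneg w) h1 hκ

theorem shellIntegral_le {N : ℕ} {r : ℝ} (hr : 0 < r) : shellIntegral N r ≤ (r ^ (N - 1))⁻¹ := by
  calc shellIntegral N r ≤ ∫ s in Set.Ioc r (r + 1), (r ^ (N - 1))⁻¹ := by
        refine setIntegral_mono_on (integrableOn_inv_pow hr _) (by simp) measurableSet_Ioc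
          fun s hs => ?_
        have := hs.1.le
        gcongr
    _ = _ := by simp

/-- The exact logarithm matters: exponentiating it produces the weight 1 + 1/r of dimension two. -/
theorem shellIntegral_two {r : ℝ} (hr : 0 < r) : shellIntegral 2 r = Real.log (1 + r⁻¹) := by
  rw [shellIntegral, ← intervalIntegral.integral_of_le (by linarith)]
  simp only [Nat.add_one_sub_one, pow_one]
  rw [integral_inv_of_pos hr (by linarith), add_div, div_self hr.ne', one_div]

/-- On the shell s^{1−N} ≤ r^{3−N} s^{−2}, and ∫_r^{r+1} s^{−2} ds ≤ 1/r. Near the origin this gains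
a power of r over `shellIntegral_le`; the resulting exponent N − 2 is the one matching the critical
growth. -/
theorem shellIntegral_le_of_three_le {N : ℕ} (hN : 3 ≤ N) {r : ℝ} (hr : 0 < r) :
    shellIntegral N r ≤ (r ^ (N - 2))⁻¹ := by
  have hsq : ∫ s in Set.Ioc r (r + 1), (s ^ 2)⁻¹ ≤ r⁻¹ := by
    have h := integral_zpow (a := r) (b := r + 1) (n := -2)
      (.inr ⟨by norm_num, Set.notMem_uIcc_of_lt hr (by linarith)⟩)
    rw [← intervalIntegral.integral_of_le (by linarith)]
    have e : ∀ s : ℝ, s ^ (-2 : ℤ) = (s ^ 2)⁻¹ := fun s => by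
      rw [zpow_neg]; rfl
    simp only [e] at h
    rw [h]
    have : 0 < (r + 1)⁻¹ := by positivity
    norm_num [zpow_neg_one]
    linarith
  calc shellIntegral N r ≤ ∫ s in Set.Ioc r (r + 1), (r ^ (N - 3))⁻¹ * (s ^ 2)⁻¹ := by
        refine setIntegral_mono_on (integrableOn_inv_pow hr _)
          ((integrableOn_inv_pow hr 2).const_mul _) measurableSet_Ioc fun s hs => ?_
        have h1 := hs.1.le
        have h2 : N - 1 = N - 3 + 2 := by omega
        rw [h2, pow_add, mul_inv]
        gcongr
    _ ≤ (r ^ (N - 3))⁻¹ * r⁻¹ := by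
        rw [integral_const_mul]
        gcongr
    _ = _ := by
        rw [← mul_inv, ← pow_succ]
        congr 2
        omega

/-! ### A Hardy-type inequality. -/

open scoped ENNReal

theorem lintegral_mul_sq_le {α : Type*} [MeasurableSpace α] {μ : Measure α} {f g : α → ℝ≥0∞}
    (hf : AEMeasurable f μ) (hg : AEMeasurable g μ) :
    (∫⁻ x, f x * g x ∂μ) ^ 2 ≤ (∫⁻ x, f x ^ 2 ∂μ) * ∫⁻ x, g x ^ 2 ∂μ := by
  have h := ENNReal.lintegral_mul_le_Lp_mul_Lq μ Real.HolderConjugate.two_two hf hg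
  simp only [ENNReal.rpow_two] at h
  calc _ ≤ ((∫⁻ x, f x ^ 2 ∂μ) ^ (1 / 2 : ℝ) * (∫⁻ x, g x ^ 2 ∂μ) ^ (1 / 2 : ℝ)) ^ 2 := by
        gcongr; exact h
    _ = _ := by
      rw [mul_pow, ← ENNReal.rpow_natCast, ← ENNReal.rpow_natCast, ← ENNReal.rpow_mul,
        ← ENNReal.rpow_mul]
      norm_num

theorem lintegral_comp_norm_le {N : ℕ} (hN : 1 ≤ N) {F : ℝ → ℝ} (hF : ∀ s, 0 ≤ F s)
    (hi : IntegrableOn (fun s => s ^ (N - 1) * F s) (Set.Ioi 0)) {c : ℝ}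
    (hc : ∫ s in Set.Ioi (0 : ℝ), s ^ (N - 1) * F s ≤ c) :
    ∫⁻ x : Space N, ENNReal.ofReal (F ‖x‖) ≤ ENNReal.ofReal (sphereArea N * c) := by
  rw [← ofReal_integral_eq_lintegral_ofReal ((integrable_comp_norm_iff hN F).2 hi)
    (.of_forall fun x => hF _), integral_comp_norm hN]
  exact ENNReal.ofReal_le_ofReal (mul_le_mul_of_nonneg_left hc (sphereArea_pos hN).le)

theorem pow_pred_mul_rpow {N : ℕ} (hN : 1 ≤ N) {s : ℝ} (hs : 0 < s) (e : ℝ) :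
    s ^ (N - 1) * s ^ e = s ^ ((N : ℝ) - 1 + e) := by
  rw [← Real.rpow_natCast, ← Real.rpow_add hs, Nat.cast_sub hN, Nat.cast_one]

theorem lintegral_rpow_outside_le {N : ℕ} (hN : 1 ≤ N) {r : ℝ} (hr : 0 < r) :
    ∫⁻ y : Space N, ENNReal.ofReal
      ((Set.Ioi r).indicator (fun s => s ^ (-(N : ℝ) - 1 / 2)) ‖y‖) ≤
      ENNReal.ofReal (sphereArea N * (2 * r ^ (-1 / 2 : ℝ))) := by
  have e : Set.EqOn (fun s : ℝ => s ^ (N - 1) *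
      (Set.Ioi r).indicator (fun s => s ^ (-(N : ℝ) - 1 / 2)) s)
      ((Set.Ioi r).indicator fun s => s ^ (-3 / 2 : ℝ)) (Set.Ioi 0) := by
    intro s hs
    by_cases h : s ∈ Set.Ioi r
    · simp only [Set.indicator_of_mem h]
      rw [pow_pred_mul_rpow hN hs]
      congr 1
      ring
    · simp [Set.indicator_of_notMem h]
  have hi : IntegrableOn (fun s : ℝ => s ^ (-3 / 2 : ℝ)) (Set.Ioi r) :=
    integrableOn_Ioi_rpow_of_lt (by norm_num) hr
  refine lintegral_comp_norm_le (F := (Set.Ioi r).indicator fun s => s ^ (-(N : ℝ) - 1 / 2)) hN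
    (fun s => Set.indicator_apply_nonneg fun h =>
    Real.rpow_nonneg (hr.trans h).le _) ?_ ?_
  · rw [integrableOn_congr_fun e measurableSet_Ioi]
    exact ((integrable_indicator_iff measurableSet_Ioi).2 hi).integrableOn
  · rw [setIntegral_congr_fun measurableSet_Ioi e, setIntegral_indicator measurableSet_Ioi,
      Set.inter_eq_right.2 (Set.Ioi_subset_Ioi hr.le), integral_Ioi_rpow_of_lt (by norm_num) hr]
    norm_num
    linarith

theorem lintegral_rpow_inside_le {N : ℕ} (hN : 1 ≤ N) {e t : ℝ} (he : 0 < N + e) (ht : 0 < t) :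
    ∫⁻ x : Space N, ENNReal.ofReal ((Set.Ioo 0 t).indicator (fun s => s ^ e) ‖x‖) ≤
      ENNReal.ofReal (sphereArea N * (t ^ (N + e) / (N + e))) := by
  have heq : Set.EqOn (fun s : ℝ => s ^ (N - 1) * (Set.Ioo 0 t).indicator (fun s => s ^ e) s)
      ((Set.Ioo 0 t).indicator fun s => s ^ ((N : ℝ) - 1 + e)) (Set.Ioi 0) := by
    intro s hs
    by_cases h : s ∈ Set.Ioo 0 t
    · simp only [Set.indicator_of_mem h]
      rw [pow_pred_mul_rpow hN hs]
    · simp [Set.indicator_of_notMem h]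
  have hi : IntervalIntegrable (fun s : ℝ => s ^ ((N : ℝ) - 1 + e)) volume 0 t :=
    intervalIntegral.intervalIntegrable_rpow' (by linarith)
  have hi' : IntegrableOn (fun s : ℝ => s ^ ((N : ℝ) - 1 + e)) (Set.Ioo 0 t) :=
    ((intervalIntegrable_iff_integrableOn_Ioo_of_le ht.le).1 hi)
  refine lintegral_comp_norm_le (F := (Set.Ioo 0 t).indicator fun s => s ^ e) hN
    (fun s => Set.indicator_apply_nonneg fun h =>
    Real.rpow_nonneg h.1.le _) ?_ ?_
  · rw [integrableOn_congr_fun heq measurableSet_Ioi]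
    exact ((integrable_indicator_iff measurableSet_Ioo).2 hi').integrableOn
  · rw [setIntegral_congr_fun measurableSet_Ioi heq, setIntegral_indicator measurableSet_Ioo,
      Set.inter_eq_right.2 (fun s hs => hs.1), ← integral_Ioc_eq_integral_Ioo,
      ← intervalIntegral.integral_of_le ht.le, integral_rpow (.inl (by linarith))]
    rw [show (N : ℝ) - 1 + e + 1 = N + e by ring, Real.zero_rpow he.ne', sub_zero]

/-- Weighted estimate near the origin for the averaging operator with kernel `kernel₁`. -/
theorem lintegral_kernel₁_hardy {N : ℕ} (hN : 1 ≤ N) {γ : ℝ} (hγ : γ ≤ 2)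
    (hNγ : γ + 1 / 2 < N) {G : Space N → ℝ≥0∞} (hG : AEMeasurable G) :
    ∫⁻ x : Space N, ENNReal.ofReal ((Set.Ioo 0 1).indicator (fun s => s ^ (-γ)) ‖x‖) *
        (∫⁻ y, G y * ENNReal.ofReal (kernel₁ ‖x‖ y)) ^ 2 ≤
      ENNReal.ofReal (sphereArea N * 2 * (sphereArea N * (2 ^ (2 - γ) / (N - γ - 1 / 2)))) *
        ∫⁻ y, G y ^ 2 := by
  have hσ := sphereArea_pos hN
  -- Schur-test splitting s^{1−N} = a(s) b(s). The exponents make b² = s^{−N−1/2} integrable at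
  -- infinity, its integral over |y| > r being a multiple of r^{−1/2}. Truncation at 2 is harmless
  -- since |y| ≤ |x| + 1 < 2.
  set a : ℝ → ℝ := (Set.Ioo 0 2).indicator fun s => s ^ ((5 / 2 - N : ℝ) / 2) with ha
  set b : ℝ → ℝ → ℝ := fun r => (Set.Ioi r).indicator fun s => s ^ ((-(N : ℝ) - 1 / 2) / 2) with hb
  have ha0 : ∀ s, 0 ≤ a s := fun s => Set.indicator_apply_nonneg fun h => Real.rpow_nonneg h.1.le _
  have ham : Measurable a := (by fun_prop : Measurable fun s : ℝ => _).indicator measurableSet_Ioo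
  have hbm : ∀ r, Measurable (b r) := fun r =>
    (by fun_prop : Measurable fun s : ℝ => _).indicator measurableSet_Ioi
  -- Cauchy-Schwarz for fixed `x`
  have hCS : ∀ x : Space N,
      ENNReal.ofReal ((Set.Ioo 0 1).indicator (fun s => s ^ (-γ)) ‖x‖) *
        (∫⁻ y, G y * ENNReal.ofReal (kernel₁ ‖x‖ y)) ^ 2 ≤
      ∫⁻ y, (G y ^ 2 * ENNReal.ofReal (a ‖y‖ ^ 2)) * (ENNReal.ofReal (sphereArea N * 2) *
        ENNReal.ofReal ((Set.Ioo 0 ‖y‖).indicator (fun s => s ^ (-γ - 1 / 2)) ‖x‖)) := by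
    intro x
    by_cases hx : ‖x‖ ∈ Set.Ioo (0 : ℝ) 1
    swap
    · simp [Set.indicator_of_notMem hx]
    rw [Set.indicator_of_mem hx]
    have h1 : ∫⁻ y, G y * ENNReal.ofReal (kernel₁ ‖x‖ y) ≤
        ∫⁻ y, (G y * (Set.Ioi ‖x‖).indicator (fun _ => 1) ‖y‖ * ENNReal.ofReal (a ‖y‖)) *
          ENNReal.ofReal (b ‖x‖ ‖y‖) := by
      refine lintegral_mono fun y => ?_
      dsimp only
      by_cases hy : ‖y‖ ∈ Set.Ioc ‖x‖ (‖x‖ + 1)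
      · have hy0 : 0 < ‖y‖ := hx.1.trans hy.1
        have hy1 : ‖y‖ ∈ Set.Ioo (0 : ℝ) 2 := ⟨hy0, by linarith [hy.2, hx.2]⟩
        simp only [kernel₁, ha, hb, Set.indicator_of_mem hy, Set.indicator_of_mem hy1,
          Set.indicator_of_mem (Set.mem_Ioi.2 hy.1), mul_one]
        rw [mul_assoc, ← ENNReal.ofReal_mul (Real.rpow_nonneg hy0.le _), ← Real.rpow_add hy0,
          ← Real.rpow_natCast, Nat.cast_sub hN, ← Real.rpow_neg hy0.le]
        refine le_of_eq ?_
        congr 3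
        push_cast
        ring
      · simp [kernel₁, Set.indicator_of_notMem hy]
    have h2 : (∫⁻ y, G y * ENNReal.ofReal (kernel₁ ‖x‖ y)) ^ 2 ≤
        (∫⁻ y, (G y ^ 2 * ENNReal.ofReal (a ‖y‖ ^ 2)) *
          (Set.Ioi ‖x‖).indicator (fun _ => 1) ‖y‖) *
        ENNReal.ofReal (sphereArea N * (2 * ‖x‖ ^ (-1 / 2 : ℝ))) := by
      calc _ ≤ _ := pow_le_pow_left' h1 2
        _ ≤ _ := lintegral_mul_sq_le ?_ ?_
        _ ≤ _ := ?_
      · refine (hG.mul ?_).mul (ham.comp measurable_norm).ennreal_ofReal.aemeasurable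
        exact ((measurable_const.indicator measurableSet_Ioi).comp measurable_norm).aemeasurable
      · exact ((hbm _).comp measurable_norm).ennreal_ofReal.aemeasurable
      · refine mul_le_mul' (lintegral_mono fun y => le_of_eq ?_)
          (le_trans (lintegral_mono fun y => le_of_eq ?_) (lintegral_rpow_outside_le hN hx.1))
        · rw [ENNReal.ofReal_pow (ha0 _)]
          by_cases h : ‖y‖ ∈ Set.Ioi ‖x‖
          · simp only [Set.indicator_of_mem h]; ring
          · simp [Set.indicator_of_notMem h]
        · by_cases h : ‖y‖ ∈ Set.Ioi ‖x‖
          · have hy0 : 0 < ‖y‖ := hx.1.trans h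
            simp only [hb, Set.indicator_of_mem h]
            rw [← ENNReal.ofReal_pow (Real.rpow_nonneg hy0.le _), ← Real.rpow_mul_natCast hy0.le]
            congr 2
            push_cast
            ring
          · simp [hb, Set.indicator_of_notMem h]
    calc _ ≤ _ := mul_le_mul' le_rfl h2
      _ = (∫⁻ y, (G y ^ 2 * ENNReal.ofReal (a ‖y‖ ^ 2)) *
          (Set.Ioi ‖x‖).indicator (fun _ => 1) ‖y‖) *
          (ENNReal.ofReal (sphereArea N * 2) * ENNReal.ofReal (‖x‖ ^ (-γ - 1 / 2))) := by
        rw [mul_left_comm, ← ENNReal.ofReal_mul (Real.rpow_nonneg hx.1.le _),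
          ← ENNReal.ofReal_mul (by positivity)]
        congr 2
        rw [show -γ - 1 / 2 = -γ + (-1 / 2) by ring, Real.rpow_add hx.1]
        ring
      _ = _ := by
        rw [← lintegral_mul_const'' _ ?_]
        · refine lintegral_congr fun y => ?_
          by_cases h : ‖x‖ < ‖y‖
          · have h' : ‖x‖ ∈ Set.Ioo 0 ‖y‖ := ⟨hx.1, h⟩
            simp [Set.indicator_of_mem h', h]
          · have h' : ‖x‖ ∉ Set.Ioo 0 ‖y‖ := fun h' => h h'.2
            simp [h]
        · refine ((hG.pow_const 2).mul
            ((ham.comp measurable_norm).pow_const 2).ennreal_ofReal.aemeasurable).mul ?_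
          exact ((measurable_const.indicator measurableSet_Ioi).comp measurable_norm).aemeasurable
  refine (lintegral_mono hCS).trans ?_
  rw [lintegral_lintegral_swap]
  swap
  · refine AEMeasurable.mul ?_ (AEMeasurable.const_mul ?_ _)
    · exact ((hG.pow_const 2).mul
        ((ham.comp measurable_norm).pow_const 2).ennreal_ofReal.aemeasurable).comp_snd
    · refine Measurable.aemeasurable (Measurable.ennreal_ofReal ?_)
      have : (fun p : Space N × Space N =>
          (Set.Ioo 0 ‖p.2‖).indicator (fun s : ℝ => s ^ (-γ - 1 / 2)) ‖p.1‖) =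
          {p : Space N × Space N | 0 < ‖p.1‖ ∧ ‖p.1‖ < ‖p.2‖}.indicator
            fun p => ‖p.1‖ ^ (-γ - 1 / 2) := by
        ext p
        simp [Set.indicator_apply]
      rw [this]
      refine (measurable_fst.norm.pow_const _).indicator ?_
      exact (measurableSet_lt measurable_const measurable_fst.norm).inter
        (measurableSet_lt measurable_fst.norm measurable_snd.norm)
  rw [← lintegral_const_mul'' _ (hG.pow_const 2)]
  refine lintegral_mono_ae ?_
  filter_upwards [ae_norm_pos hN] with y hy
  rw [lintegral_const_mul'' _ ?_, lintegral_const_mul'' _ ?_]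
  rotate_left
  · exact (((by fun_prop : Measurable fun s : ℝ => _).indicator measurableSet_Ioo).comp
      measurable_norm).ennreal_ofReal.aemeasurable
  · exact (((by fun_prop : Measurable fun s : ℝ => _).indicator measurableSet_Ioo).comp
      measurable_norm).ennreal_ofReal.aemeasurable.const_mul _
  -- After exchanging the integrals, |x|^{−γ−1/2} is integrated over |x| < |y|; this is finite
  -- exactly because γ + 1/2 < N.
  have hin := lintegral_rpow_inside_le (e := -γ - 1 / 2) (t := ‖y‖) hN (by linarith) hy
  calc _ ≤ G y ^ 2 * ENNReal.ofReal (a ‖y‖ ^ 2) * (ENNReal.ofReal (sphereArea N * 2) *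
        ENNReal.ofReal (sphereArea N * (‖y‖ ^ (N + (-γ - 1 / 2)) / (N + (-γ - 1 / 2))))) := by
        gcongr
    _ = G y ^ 2 * ENNReal.ofReal (a ‖y‖ ^ 2 * (sphereArea N * 2 *
          (sphereArea N * (‖y‖ ^ (N + (-γ - 1 / 2)) / (N + (-γ - 1 / 2)))))) := by
        rw [mul_assoc, ← ENNReal.ofReal_mul (by positivity), ← ENNReal.ofReal_mul (by positivity)]
    _ ≤ _ := by
        rw [mul_comm (G y ^ 2)]
        refine mul_le_mul' (ENNReal.ofReal_le_ofReal ?_) le_rfl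
        by_cases h : ‖y‖ ∈ Set.Ioo (0 : ℝ) 2
        · simp only [ha, Set.indicator_of_mem h]
          rw [← Real.rpow_mul_natCast hy.le]
          -- The surviving power |y|^{2−γ} is bounded for |y| < 2 because γ ≤ 2.
          have e : ‖y‖ ^ ((5 / 2 - N : ℝ) / 2 * (2 : ℕ)) * ‖y‖ ^ (N + (-γ - 1 / 2)) =
              ‖y‖ ^ (2 - γ) := by
            rw [← Real.rpow_add hy]
            congr 1
            push_cast
            ring
          have hp : 0 < (N : ℝ) + (-γ - 1 / 2) := by linarith
          calc _ = sphereArea N * 2 * (sphereArea N * ((‖y‖ ^ ((5 / 2 - N : ℝ) / 2 * (2 : ℕ)) *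
                ‖y‖ ^ (N + (-γ - 1 / 2))) / (N + (-γ - 1 / 2)))) := by ring
            _ = sphereArea N * 2 * (sphereArea N * (‖y‖ ^ (2 - γ) / (N - γ - 1 / 2))) := by
              rw [e, show (N : ℝ) + (-γ - 1 / 2) = N - γ - 1 / 2 by ring]
            _ ≤ _ := by
              have : 0 < (N : ℝ) - γ - 1 / 2 := by linarith
              have h2 : (0:ℝ) ≤ 2 - γ := by linarith
              have h3 := h.2.le
              gcongr
        · have : 0 < (N : ℝ) - γ - 1 / 2 := by linarith
          simp only [ha, Set.indicator_of_notMem h]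
          have h2 : (0 : ℝ) ^ 2 * (sphereArea N * 2 * (sphereArea N *
            (‖y‖ ^ (N + (-γ - 1 / 2)) / (N + (-γ - 1 / 2))))) = 0 := by ring
          rw [h2]
          positivity

end Kirchhoff

/-! ### The weighted L² estimate. -/

namespace Kirchhoff

open scoped ENNReal

/-- The exponent of the singular weight for which a Hardy-type inequality is used. -/
def hardyExp (N : ℕ) : ℕ := if N = 2 then 1 else 2

/-- The singular weight `1 + r^{-γ}`, with `γ = 2` if `N ≥ 3` and `γ = 1` if `N = 2`. -/
noncomputable def weight (N : ℕ) (r : ℝ) : ℝ := 1 + (r ^ hardyExp N)⁻¹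

theorem one_le_weight (N : ℕ) {r : ℝ} (hr : 0 ≤ r) : 1 ≤ weight N r := by
  unfold weight
  have : 0 ≤ (r ^ hardyExp N)⁻¹ := by positivity
  linarith

theorem measurable_weight (N : ℕ) : Measurable (weight N) := by
  unfold weight
  fun_prop

theorem enorm_radialMean_le {N : ℕ} (hN : 1 ≤ N) (w : H1 N) {r : ℝ} (hr : 0 ≤ r) :
    ‖radialMean w r‖ₑ ≤ ∫⁻ y, ENNReal.ofReal (|fn w y| + ‖grad w y‖) *
      ENNReal.ofReal (kernel₁ r y) := by
  refine (enorm_integral_le_lintegral_enorm _).trans (lintegral_mono fun y => ?_)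
  rw [← ENNReal.ofReal_mul (by positivity), Real.enorm_eq_ofReal_abs]
  exact ENNReal.ofReal_le_ofReal (abs_integrand_le hN w hr y)

theorem integrable_fn_sq {N : ℕ} (w : H1 N) : Integrable fun x => fn w x ^ 2 :=
  (memLp_fn w).integrable_sq

theorem integrable_norm_grad_sq {N : ℕ} (w : H1 N) : Integrable fun x => ‖grad w x‖ ^ 2 :=
  (memLp_two_iff_integrable_sq_norm (memLp_grad w).1).1 (memLp_grad w)

theorem lintegral_fn_grad_sq_le {N : ℕ} (w : H1 N) :
    ∫⁻ y, ENNReal.ofReal (|fn w y| + ‖grad w y‖) ^ 2 ≤ ENNReal.ofReal (2 * h1Norm w ^ 2) := by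
  rw [h1Norm_sq, norm_fst_sq, norm_snd_sq, ← integral_add (integrable_fn_sq w)
    (integrable_norm_grad_sq w), ← integral_const_mul,
    ofReal_integral_eq_lintegral_ofReal (by
      exact ((integrable_fn_sq w).add (integrable_norm_grad_sq w)).const_mul 2)
      (.of_forall fun x => by positivity)]
  refine lintegral_mono fun y => ?_
  dsimp only
  rw [← ENNReal.ofReal_pow (by positivity)]
  refine ENNReal.ofReal_le_ofReal ?_
  rw [← sq_abs (fn w y)]
  nlinarith [sq_nonneg (|fn w y| - ‖grad w y‖)]

theorem integral_fn_sq_le {N : ℕ} (w : H1 N) : ∫ x, fn w x ^ 2 ≤ h1Norm w ^ 2 := by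
  rw [← norm_fst_sq, h1Norm_sq]
  linarith [sq_nonneg ‖w.1.snd‖]

/-- The weighted `L²` estimate for radial functions. -/
theorem exists_weighted_bound {N : ℕ} (hN : 2 ≤ N) : ∃ C : ℝ, 0 < C ∧ ∀ w : H1 N, IsRadial w →
    Integrable (fun x => weight N ‖x‖ * fn w x ^ 2) ∧
      ∫ x, weight N ‖x‖ * fn w x ^ 2 ≤ C * h1Norm w ^ 2 := by
  have hN1 : 1 ≤ N := by omega
  have hσ := sphereArea_pos hN1
  obtain ⟨γ, hγ⟩ : ∃ γ : ℝ, γ = ((hardyExp N : ℕ) : ℝ) := ⟨_, rfl⟩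
  have hN2 : (2 : ℝ) ≤ N := by exact_mod_cast hN
  have hγ2 : γ ≤ 2 := by
    simp only [hγ, hardyExp]; split_ifs <;> norm_num
  -- This inequality excludes γ = 2 in dimension two, which is why `hardyExp` is 1 there.
  have hγN : γ + 1 / 2 < N := by
    by_cases h : N = 2
    · simp only [hγ, hardyExp, h, if_true]; norm_num
    · have : (3 : ℝ) ≤ N := by exact_mod_cast (by omega : 3 ≤ N)
      linarith
  obtain ⟨c, hc⟩ : ∃ c : ℝ,
    c = sphereArea N * 2 * (sphereArea N * (2 ^ (2 - γ) / (N - γ - 1 / 2))) := ⟨_, rfl⟩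
  have hc0 : 0 ≤ c := by
    have : 0 < (N : ℝ) - γ - 1 / 2 := by linarith
    rw [hc]
    positivity
  -- The weight is at most 2 for |x| ≥ 1 and at most 2 + |x|^{−γ} inside. The singular part costs
  -- the Hardy constant c, a factor 2 from (|u| + |∇u|)² ≤ 2(u² + |∇u|²), and the squared area from
  -- the reproducing formula.
  refine ⟨2 + c * 2 / sphereArea N ^ 2, by positivity, fun w hw => ?_⟩
  obtain ⟨q, hq⟩ : ∃ q : Space N → ℝ, q = fun x =>
    (Set.Ioo 0 1).indicator (fun s : ℝ => s ^ (-γ)) ‖x‖ * fn w x ^ 2 := ⟨_, rfl⟩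
  have hq0 : ∀ x, 0 ≤ q x := fun x => hq ▸
    mul_nonneg (Set.indicator_apply_nonneg fun h => Real.rpow_nonneg h.1.le _) (sq_nonneg _)
  have hqm : AEStronglyMeasurable q := by
    rw [hq]
    refine AEStronglyMeasurable.mul ?_ ((memLp_fn _).1.pow 2)
    exact (((by fun_prop : Measurable fun s : ℝ => s ^ (-γ)).indicator
      measurableSet_Ioo).comp measurable_norm).aestronglyMeasurable
  have hle : ∫⁻ x, ENNReal.ofReal (sphereArea N ^ 2 * q x) ≤
      ENNReal.ofReal (c * (2 * h1Norm w ^ 2)) := by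
    calc _ ≤ ∫⁻ x : Space N, ENNReal.ofReal ((Set.Ioo 0 1).indicator (fun s => s ^ (-γ)) ‖x‖) *
        (∫⁻ y, ENNReal.ofReal (|fn w y| + ‖grad w y‖) *
          ENNReal.ofReal (kernel₁ ‖x‖ y)) ^ 2 := by
          refine lintegral_mono_ae ?_
          filter_upwards [ae_eq_radialMean hN1 hw] with x hx
          have h0 : 0 ≤ (Set.Ioo 0 1).indicator (fun s : ℝ => s ^ (-γ)) ‖x‖ :=
            Set.indicator_apply_nonneg fun h => Real.rpow_nonneg h.1.le _
          rw [show sphereArea N ^ 2 * q x = (Set.Ioo 0 1).indicator (fun s : ℝ => s ^ (-γ)) ‖x‖ *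
            |sphereArea N * fn w x| ^ 2 by rw [sq_abs]; simp only [hq]; ring,
            ENNReal.ofReal_mul h0, hx, ENNReal.ofReal_pow (abs_nonneg _),
            ← Real.enorm_eq_ofReal_abs]
          gcongr
          exact enorm_radialMean_le hN1 _ (norm_nonneg x)
      _ ≤ ENNReal.ofReal c * ∫⁻ y, ENNReal.ofReal (|fn w y| + ‖grad w y‖) ^ 2 :=
          hc ▸ lintegral_kernel₁_hardy hN1 hγ2 hγN
            (((memLp_fn _).norm.1.add (memLp_grad _).norm.1).aemeasurable.ennreal_ofReal)
      _ ≤ ENNReal.ofReal c * ENNReal.ofReal (2 * h1Norm w ^ 2) := by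
          gcongr
          exact lintegral_fn_grad_sq_le _
      _ = _ := (ENNReal.ofReal_mul hc0).symm
  have hqi' : Integrable fun x => sphereArea N ^ 2 * q x := by
    refine ⟨hqm.const_mul _, ?_⟩
    rw [hasFiniteIntegral_iff_ofReal (.of_forall fun x => mul_nonneg (sq_nonneg _) (hq0 x))]
    exact hle.trans_lt ENNReal.ofReal_lt_top
  have hqi : Integrable q := by
    refine (hqi'.const_mul (sphereArea N ^ 2)⁻¹).congr (.of_forall fun x => ?_)
    have : sphereArea N ≠ 0 := hσ.ne'
    field_simp
  have hqle : ∫ x, q x ≤ c * 2 / sphereArea N ^ 2 * h1Norm w ^ 2 := by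
    have h1 : ∫ x, sphereArea N ^ 2 * q x ≤ c * (2 * h1Norm w ^ 2) := by
      rw [integral_eq_lintegral_of_nonneg_ae
        (.of_forall fun x => mul_nonneg (sq_nonneg _) (hq0 x)) hqi'.1]
      exact ENNReal.toReal_le_of_le_ofReal (by positivity) hle
    rw [integral_const_mul] at h1
    rw [div_mul_eq_mul_div, le_div_iff₀ (by positivity)]
    linarith
  have hu := integrable_fn_sq w
  have hbound : ∀ᵐ x : Space N, weight N ‖x‖ * fn w x ^ 2 ≤
      2 * fn w x ^ 2 + q x := by
    filter_upwards [ae_norm_pos hN1] with x hx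
    simp only [hq, weight]
    rw [← add_mul]
    refine mul_le_mul_of_nonneg_right ?_ (sq_nonneg _)
    by_cases h : ‖x‖ < 1
    · rw [Set.indicator_of_mem (show ‖x‖ ∈ Set.Ioo (0:ℝ) 1 from ⟨hx, h⟩), Real.rpow_neg hx.le, hγ,
        Real.rpow_natCast]
      linarith
    · have : (‖x‖ ^ hardyExp N)⁻¹ ≤ 1 := inv_le_one_of_one_le₀ (one_le_pow₀ (not_lt.1 h))
      rw [Set.indicator_of_notMem fun h' => h h'.2]
      linarith
  have hi : Integrable fun x => weight N ‖x‖ * fn w x ^ 2 := by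
    refine ((hu.const_mul 2).add hqi).mono ?_ ?_
    · exact ((measurable_weight N).comp measurable_norm).aestronglyMeasurable.mul
        ((memLp_fn _).1.pow 2)
    · filter_upwards [hbound] with x hx
      have : 0 ≤ weight N ‖x‖ := zero_le_one.trans (one_le_weight N (norm_nonneg x))
      rw [Real.norm_of_nonneg (by positivity)]
      exact hx.trans (le_abs_self _)
  refine ⟨hi, ?_⟩
  calc _ ≤ ∫ x, (2 * fn w x ^ 2 + q x) :=
        integral_mono_ae hi ((hu.const_mul 2).add hqi) hbound
    _ = 2 * (∫ x, fn w x ^ 2) + ∫ x, q x := by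
        rw [integral_add (hu.const_mul 2) hqi, integral_const_mul]
    _ ≤ 2 * h1Norm w ^ 2 + c * 2 / sphereArea N ^ 2 * h1Norm w ^ 2 := by
        have h1 : ∫ x, fn w x ^ 2 ≤ h1Norm w ^ 2 := integral_fn_sq_le w
        linarith
    _ = _ := by ring


end Kirchhoff

/-! ### The growth of f measured against the weight. -/

namespace Kirchhoff

theorem radialBound_sq_le {N : ℕ} (hN : 1 ≤ N) {r : ℝ} (hr : 0 < r) :
    radialBound N r ^ 2 ≤ 2 / sphereArea N * (r ^ (N - 1))⁻¹ := by
  have := sphereArea_pos hN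
  rw [radialBound_sq hN hr]
  gcongr
  exact shellIntegral_le hr

/-- Decay like r^{−(N−1)/2}, hence the need for N ≥ 2. It places the values of a bounded sequence in
the range where (f2) applies, uniformly outside a large ball. -/
theorem exists_radialBound_le {N : ℕ} (hN : 2 ≤ N) {δ : ℝ} (hδ : 0 < δ) :
    ∃ R > 0, ∀ r ≥ R, radialBound N r ≤ δ := by
  have hσ := sphereArea_pos (by omega : 1 ≤ N)
  refine ⟨max 1 (2 / sphereArea N / δ ^ 2), by positivity, fun r hr => ?_⟩
  have h1 : 1 ≤ r := (le_max_left _ _).trans hr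
  have h2 : 2 / sphereArea N / δ ^ 2 ≤ r := (le_max_right _ _).trans hr
  refine (pow_le_pow_iff_left₀ (radialBound_nonneg _ _) hδ.le two_ne_zero).1 ?_
  refine (radialBound_sq_le (by omega) (by linarith)).trans ?_
  have h3 : r ≤ r ^ (N - 1) := le_self_pow₀ h1 (by omega)
  have h4 : 0 < r ^ (N - 1) := by positivity
  rw [← div_eq_mul_inv, div_le_iff₀ h4]
  rw [div_le_iff₀ (by positivity)] at h2
  nlinarith [sq_nonneg δ]

/-- The Jacobian cancels the singularity. By `radialBound_sq_le`, the squared pointwise bound is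
thus integrable on balls. -/
theorem integrableOn_inv_norm_pow {N : ℕ} (hN : 1 ≤ N) (R : ℝ) :
    IntegrableOn (fun x : Space N => (‖x‖ ^ (N - 1))⁻¹) (Metric.ball 0 R) := by
  rw [← integrable_indicator_iff measurableSet_ball]
  have h : Integrable fun x : Space N =>
      (Set.Iio R).indicator (fun s : ℝ => (s ^ (N - 1))⁻¹) ‖x‖ := by
    rw [integrable_comp_norm_iff hN]
    have e : Set.EqOn (fun s : ℝ => s ^ (N - 1) *
        (Set.Iio R).indicator (fun s : ℝ => (s ^ (N - 1))⁻¹) s)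
        ((Set.Ioo 0 R).indicator fun _ => 1) (Set.Ioi 0) := by
      intro s hs
      have hs0 : s ^ (N - 1) ≠ 0 := pow_ne_zero _ (Set.mem_Ioi.1 hs).ne'
      by_cases h : s < R
      · have h' : s ∈ Set.Ioo 0 R := ⟨hs, h⟩
        simp [Set.indicator_of_mem h', h, hs0]
      · have h' : s ∉ Set.Ioo 0 R := fun h' => h h'.2
        simp [h]
    rw [integrableOn_congr_fun e measurableSet_Ioi]
    exact ((integrable_indicator_iff measurableSet_Ioo).2 (by simp)).integrableOn
  refine h.congr (.of_forall fun x => ?_)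
  dsimp only
  by_cases h' : ‖x‖ < R
  · rw [Set.indicator_of_mem (show ‖x‖ ∈ Set.Iio R from h'),
      Set.indicator_of_mem (by simpa using h')]
  · rw [Set.indicator_of_notMem (show ‖x‖ ∉ Set.Iio R from h'),
      Set.indicator_of_notMem (by simpa using h')]

theorem exists_linear_near_zero {f : ℝ → ℝ} (h1 : F1 f) (h2 : F2 f) :
    ∃ m M δ : ℝ, 0 < m ∧ 0 ≤ M ∧ 0 < δ ∧
      ∀ t, |t| ≤ δ → f t * t ≤ -m * t ^ 2 ∧ |f t| ≤ M * |t| := by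
  obtain ⟨l, hl1, hl2⟩ := EReal.lt_iff_exists_real_btwn.1 h2.1
  obtain ⟨q, hq1, hq2⟩ := EReal.lt_iff_exists_real_btwn.1 h2.2
  have e1 : ∀ᶠ t : ℝ in 𝓝[≠] 0, (l : EReal) < ((f t / t : ℝ) : EReal) :=
    eventually_lt_of_lt_liminf hl2
  have e2 : ∀ᶠ t : ℝ in 𝓝[≠] 0, ((f t / t : ℝ) : EReal) < q := eventually_lt_of_limsup_lt hq1
  have e := eventually_nhdsWithin_iff.1 (e1.and e2)
  obtain ⟨ε, hε, hb⟩ := Metric.eventually_nhds_iff.1 e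
  have hq0 : q < 0 := by exact_mod_cast hq2
  have hf0 : f 0 = 0 := by
    have := h1.2 0
    rw [neg_zero] at this
    linarith
  -- For small t ≠ 0 the quotient f(t)/t lies strictly between l and q < 0. Halving ε turns the open
  -- neighbourhood into a closed condition.
  refine ⟨-q, |l|, ε / 2, by linarith, abs_nonneg _, by linarith, fun t ht => ?_⟩
  by_cases h : t = 0
  · simp [h, hf0]
  have hb' := hb (show dist t 0 < ε by rw [Real.dist_eq, sub_zero]; linarith) h
  have hl : l < f t / t := by exact_mod_cast hb'.1
  have hq : f t / t < q := by exact_mod_cast hb'.2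
  have ef : f t = f t / t * t := by field_simp
  constructor
  · rw [ef, neg_neg, mul_assoc, ← sq]
    exact mul_le_mul_of_nonneg_right hq.le (sq_nonneg _)
  · rw [ef, abs_mul]
    refine mul_le_mul_of_nonneg_right ?_ (abs_nonneg _)
    rw [abs_of_neg (hq.trans hq0), abs_of_neg (hl.trans (hq.trans hq0))]
    linarith

/-- Subcritical growth relative to the singular weight. -/
theorem exists_subcritical_bound {N : ℕ} (hN : 2 ≤ N) {f : ℝ → ℝ} (h1 : F1 f) (h3 : F3 N f)
    (A : ℝ) {ε : ℝ} (hε : 0 < ε) : ∃ D : ℝ, 0 ≤ D ∧ ∀ r > 0, ∀ t, |t| ≤ A * radialBound N r →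
      |f t| ≤ ε * |t| * weight N r + D := by
  have hN1 : 1 ≤ N := by omega
  have hσ := sphereArea_pos hN1
  -- it suffices to find a comparison function `P`
  suffices H : ∃ P : ℝ → ℝ, ∃ c > 0, (∀ t, 0 < t → 0 ≤ P t) ∧ (∀ r > 0, ∀ t > 0,
      t ≤ A * radialBound N r → P t ≤ c * weight N r) ∧
      ∀ η > 0, ∃ T ≥ 1, ∀ t ≥ T, |f t| ≤ η * (t * P t) by
    obtain ⟨P, c, hc, hP0, hPW, hPf⟩ := H
    obtain ⟨T, hT, hTf⟩ := hPf (ε / c) (by positivity)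
    obtain ⟨D, hD⟩ := (isCompact_Icc (a := -T) (b := T)).exists_bound_of_continuousOn
      h1.1.continuousOn
    have hD0 : 0 ≤ D := (norm_nonneg _).trans (hD 0 ⟨by linarith, by linarith⟩)
    refine ⟨D, hD0, fun r hr t ht => ?_⟩
    have hw := one_le_weight N hr.le
    by_cases htT : |t| ≤ T
    · have := hD t (abs_le.1 htT)
      rw [Real.norm_eq_abs] at this
      have : 0 ≤ ε * |t| * weight N r := by positivity
      linarith
    · have hodd : |f t| = |f (|t|)| := by
        rcases abs_choice t with h | h <;> rw [h]
        rw [h1.2, abs_neg]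
      have ht0 : 0 < |t| := by linarith
      have h4 := hTf |t| (not_le.1 htT).le
      have h5 := hPW r hr |t| ht0 ht
      rw [hodd]
      calc |f (|t|)| ≤ ε / c * (|t| * P |t|) := h4
        _ ≤ ε / c * (|t| * (c * weight N r)) := by gcongr
        _ = ε * |t| * weight N r := by field_simp
        _ ≤ _ := by linarith
  by_cases hN2 : N = 2
  · subst hN2
    -- With this B the constraint on t gives t²/B ≤ log(1 + 1/r). The added 1 keeps B positive when
    -- A = 0.
    set B : ℝ := A ^ 2 * (2 / sphereArea 2) + 1 with hB
    have hB0 : 0 < B := by positivity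
    refine ⟨fun t => Real.exp (B⁻¹ * t ^ 2), 1, one_pos, fun t _ => (Real.exp_pos _).le, ?_, ?_⟩
    · intro r hr t ht htA
      have h5 : t ^ 2 ≤ B * Real.log (1 + r⁻¹) := by
        have hlog : 0 ≤ Real.log (1 + r⁻¹) := Real.log_nonneg (by
          have : 0 < r⁻¹ := by positivity
          linarith)
        calc t ^ 2 ≤ (A * radialBound 2 r) ^ 2 := by gcongr
          _ = A ^ 2 * (2 / sphereArea 2) * Real.log (1 + r⁻¹) := by
            rw [mul_pow, radialBound_sq hN1 hr, shellIntegral_two hr, mul_assoc]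
          _ ≤ _ := by
            refine mul_le_mul_of_nonneg_right ?_ hlog
            linarith
      have h6 : B⁻¹ * t ^ 2 ≤ Real.log (1 + r⁻¹) := by
        rw [inv_mul_le_iff₀ hB0]; exact h5
      calc Real.exp (B⁻¹ * t ^ 2) ≤ Real.exp (Real.log (1 + r⁻¹)) := Real.exp_le_exp.2 h6
        _ = 1 + r⁻¹ := Real.exp_log (by positivity)
        _ = _ := by simp [weight, hardyExp]
    · intro η hη
      have := h3.2 rfl B⁻¹ (by positivity)
      have h7 : ∀ᶠ t : ℝ in atTop, |f t / Real.exp (B⁻¹ * t ^ 2)| < η := by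
        simpa only [Real.dist_eq, sub_zero] using Metric.tendsto_nhds.1 this η hη
      obtain ⟨T, hT⟩ := eventually_atTop.1 h7
      refine ⟨max T 1, le_max_right _ _, fun t ht => ?_⟩
      have h8 := hT t ((le_max_left _ _).trans ht)
      have h9 : 1 ≤ t := (le_max_right _ _).trans ht
      rw [abs_div, abs_of_pos (Real.exp_pos _), div_lt_iff₀ (Real.exp_pos _)] at h8
      refine h8.le.trans ?_
      gcongr
      exact le_mul_of_one_le_left (Real.exp_pos _).le h9
  · have hN3 : 3 ≤ N := by omega
    have hN3' : (3 : ℝ) ≤ N := by exact_mod_cast hN3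
    -- For P(t) = (t²)^e, t P(t) is the critical power t^{(N+2)/(N−2)}, while (r^{−(N−2)})^e =
    -- r^{−2} is the Hardy weight.
    set e : ℝ := 2 / ((N : ℝ) - 2) with he
    have he0 : 0 < e := div_pos two_pos (by linarith)
    set B : ℝ := A ^ 2 * (2 / sphereArea N) with hB
    have hB0 : 0 ≤ B := by positivity
    refine ⟨fun t => (t ^ 2) ^ e, B ^ e + 1, by positivity, fun t _ => by positivity, ?_, ?_⟩
    · intro r hr t ht htA
      have h5 : t ^ 2 ≤ B * (r ^ (N - 2))⁻¹ := by
        calc t ^ 2 ≤ (A * radialBound N r) ^ 2 := by gcongr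
          _ = B * shellIntegral N r := by
            rw [mul_pow, radialBound_sq hN1 hr, hB, mul_assoc]
          _ ≤ _ := by gcongr; exact shellIntegral_le_of_three_le hN3 hr
      have h6 : ((r ^ (N - 2))⁻¹) ^ e = (r ^ 2)⁻¹ := by
        rw [Real.inv_rpow (by positivity), ← Real.rpow_natCast, ← Real.rpow_mul hr.le,
          ← Real.rpow_natCast]
        congr 2
        rw [Nat.cast_sub hN, he]
        have : (N : ℝ) - 2 ≠ 0 := by linarith
        push_cast
        field_simp
      calc (t ^ 2) ^ e ≤ (B * (r ^ (N - 2))⁻¹) ^ e := by gcongr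
        _ = B ^ e * (r ^ 2)⁻¹ := by rw [Real.mul_rpow hB0 (by positivity), h6]
        _ ≤ (B ^ e + 1) * weight N r := by
          have : weight N r = 1 + (r ^ 2)⁻¹ := by simp [weight, hardyExp, hN2]
          rw [this]
          have h7 : 0 ≤ B ^ e := by positivity
          have h8 : 0 < (r ^ 2)⁻¹ := by positivity
          nlinarith
    · intro η hη
      have := h3.1 hN3
      have h7 : ∀ᶠ t : ℝ in atTop, |f t / |t| ^ (((N : ℝ) + 2) / ((N : ℝ) - 2))| < η := by
        simpa only [Real.dist_eq, sub_zero] using Metric.tendsto_nhds.1 this η hη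
      obtain ⟨T, hT⟩ := eventually_atTop.1 h7
      refine ⟨max T 1, le_max_right _ _, fun t ht => ?_⟩
      have h8 := hT t ((le_max_left _ _).trans ht)
      have h9 : 0 < t := one_pos.trans_le ((le_max_right _ _).trans ht)
      have h10 : 0 < t ^ (((N : ℝ) + 2) / ((N : ℝ) - 2)) := by positivity
      rw [abs_of_pos h9, abs_div, abs_of_pos h10, div_lt_iff₀ h10] at h8
      refine h8.le.trans (le_of_eq ?_)
      congr 1
      dsimp only
      rw [← Real.rpow_natCast, ← Real.rpow_mul h9.le]
      nth_rw 2 [← Real.rpow_one t]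
      rw [← Real.rpow_add h9, he]
      congr 1
      have : (N : ℝ) - 2 ≠ 0 := by linarith
      push_cast
      field_simp
      ring

/-- For |t| ≤ δ condition (f2) gives a linear bound, and for |t| > δ the constant D of the
subcritical bound is absorbed by (D/δ)|t|. -/
theorem exists_weighted_linear_bound {N : ℕ} (hN : 2 ≤ N) {f : ℝ → ℝ} (h1 : F1 f) (h2 : F2 f)
    (h3 : F3 N f) (A : ℝ) : ∃ C : ℝ, 0 < C ∧ ∀ r > 0, ∀ t, |t| ≤ A * radialBound N r →
      |f t| ≤ C * |t| * weight N r := by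
  obtain ⟨m, M, δ, hm, hM, hδ, hs⟩ := exists_linear_near_zero h1 h2
  obtain ⟨D, hD, hb⟩ := exists_subcritical_bound hN h1 h3 A one_pos
  refine ⟨1 + D / δ + M, by positivity, fun r hr t ht => ?_⟩
  have hw := one_le_weight N hr.le
  by_cases h : |t| ≤ δ
  · calc |f t| ≤ M * |t| := (hs t h).2
      _ ≤ M * |t| * weight N r := le_mul_of_one_le_right (by positivity) hw
      _ ≤ _ := by gcongr; linarith [(by positivity : 0 ≤ D / δ)]
  · calc |f t| ≤ 1 * |t| * weight N r + D := hb r hr t ht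
      _ ≤ 1 * |t| * weight N r + D / δ * |t| * weight N r := by
        gcongr
        have h4 : D ≤ D / δ * |t| := by
          rw [div_mul_eq_mul_div, le_div_iff₀ hδ]
          exact mul_le_mul_of_nonneg_left (not_le.1 h).le hD
        exact h4.trans (le_mul_of_one_le_right (by positivity) hw)
      _ = (1 + D / δ) * |t| * weight N r := by ring
      _ ≤ _ := by gcongr ?_ * _ * _; linarith


end Kirchhoff

/-! ### Differentiability of the potential u ↦ ∫ F(u). -/

namespace Kirchhoff

theorem integral_abs_mul_le_sqrt {α : Type*} [MeasurableSpace α] {μ : Measure α} {p q : α → ℝ}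
    (hp : MemLp p 2 μ) (hq : MemLp q 2 μ) :
    ∫ x, |p x * q x| ∂μ ≤ √(∫ x, p x ^ 2 ∂μ) * √(∫ x, q x ^ 2 ∂μ) := by
  have h := integral_mul_norm_le_Lp_mul_Lq (μ := μ) (f := p) (g := q)
    Real.HolderConjugate.two_two (by simpa using hp) (by simpa using hq)
  simpa [Real.sqrt_eq_rpow, abs_mul] using h

/-- Dominated convergence to `0` where the dominating functions may vary by a null sequence
in `L¹`. -/
theorem tendsto_integral_of_le_add {α : Type*} [MeasurableSpace α] {μ : Measure α}
    {P b : ℕ → α → ℝ} {a : α → ℝ} (hP : ∀ n, Integrable (P n) μ) (hP0 : ∀ n, ∀ᵐ x ∂μ, 0 ≤ P n x)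
    (ha : Integrable a μ) (hb : ∀ n, Integrable (b n) μ) (hb0 : ∀ n, ∀ᵐ x ∂μ, 0 ≤ b n x)
    (hle : ∀ n, ∀ᵐ x ∂μ, P n x ≤ a x + b n x)
    (hPlim : ∀ᵐ x ∂μ, Tendsto (fun n => P n x) atTop (𝓝 0))
    (hblim : Tendsto (fun n => ∫ x, b n x ∂μ) atTop (𝓝 0)) :
    Tendsto (fun n => ∫ x, P n x ∂μ) atTop (𝓝 0) := by
  -- The positive part of P_n − b_n is dominated by the fixed function |a|, so the classical theorem
  -- applies to it; adding b_n back costs only ∫ b_n.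
  have hi : ∀ n, Integrable (fun x => max (P n x - b n x) 0) μ := fun n =>
    ((hP n).sub (hb n)).pos_part
  have h1 : Tendsto (fun n => ∫ x, max (P n x - b n x) 0 ∂μ) atTop (𝓝 (∫ _, (0 : ℝ) ∂μ)) := by
    refine tendsto_integral_of_dominated_convergence (fun x => |a x|)
      (fun n => (hi n).1) ha.abs (fun n => ?_) ?_
    · filter_upwards [hle n] with x hx
      rw [Real.norm_of_nonneg (le_max_right _ _)]
      exact max_le (by linarith [le_abs_self (a x)]) (abs_nonneg _)
    · filter_upwards [hPlim, ae_all_iff.2 hP0, ae_all_iff.2 hb0] with x hx h0 h0'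
      exact squeeze_zero (fun n => le_max_right _ _)
        (fun n => max_le (by linarith [h0' n]) (h0 n)) hx
  rw [integral_zero] at h1
  have h2 := h1.add hblim
  rw [add_zero] at h2
  refine squeeze_zero (fun n => integral_nonneg_of_ae (hP0 n)) (fun n => ?_) h2
  rw [← integral_add (hi n) (hb n)]
  refine integral_mono (hP n) ((hi n).add (hb n)) fun x => ?_
  have := le_max_left (P n x - b n x) 0
  linarith

theorem fn_sub {N : ℕ} (w w' : H1 N) : fn (w - w') =ᵐ[volume] fun x => fn w x - fn w' x :=
  Lp.coeFn_sub w.1.fst w'.1.fst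

theorem fn_add {N : ℕ} (w w' : H1 N) : fn (w + w') =ᵐ[volume] fun x => fn w x + fn w' x :=
  Lp.coeFn_add w.1.fst w'.1.fst

theorem fn_smul {N : ℕ} (c : ℝ) (w : H1 N) : fn (c • w) =ᵐ[volume] fun x => c * fn w x :=
  Lp.coeFn_smul c w.1.fst

/-- Functions on `ℝ^N` satisfying the weighted bound, together with their Cauchy-Schwarz estimate. -/
theorem exists_weighted_cauchySchwarz {N : ℕ} (hN : 2 ≤ N) : ∃ C : ℝ, 0 < C ∧
    (∀ w : H1 N, IsRadial w → MemLp (fun x => √(weight N ‖x‖) * fn w x) 2 volume ∧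
      ∫ x, (√(weight N ‖x‖) * fn w x) ^ 2 ≤ C * h1Norm w ^ 2) ∧
    ∀ w w' : H1 N, IsRadial w → IsRadial w' →
      Integrable (fun x => weight N ‖x‖ * |fn w x| * |fn w' x|) ∧
      ∫ x, weight N ‖x‖ * |fn w x| * |fn w' x| ≤ C * h1Norm w * h1Norm w' := by
  obtain ⟨C, hC, hb⟩ := exists_weighted_bound hN
  have hsq : ∀ (w : H1 N) (x : Space N),
      (√(weight N ‖x‖) * fn w x) ^ 2 = weight N ‖x‖ * fn w x ^ 2 := fun w x => by
    rw [mul_pow, Real.sq_sqrt (zero_le_one.trans (one_le_weight N (norm_nonneg x)))]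
  have hmem : ∀ w : H1 N, IsRadial w → MemLp (fun x => √(weight N ‖x‖) * fn w x) 2 volume := by
    intro w hw
    refine (memLp_two_iff_integrable_sq ?_).2 ?_
    · exact ((measurable_weight N).comp measurable_norm).sqrt.aestronglyMeasurable.mul
        (memLp_fn w).1
    · simp only [hsq]
      exact (hb w hw).1
  have hle : ∀ w : H1 N, IsRadial w → ∫ x, (√(weight N ‖x‖) * fn w x) ^ 2 ≤ C * h1Norm w ^ 2 := by
    intro w hw
    simp only [hsq]
    exact (hb w hw).2
  refine ⟨C, hC, fun w hw => ⟨hmem w hw, hle w hw⟩, fun w w' hw hw' => ?_⟩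
  have e : ∀ x : Space N, weight N ‖x‖ * |fn w x| * |fn w' x| =
      |(√(weight N ‖x‖) * fn w x) * (√(weight N ‖x‖) * fn w' x)| := fun x => by
    have h0 := zero_le_one.trans (one_le_weight N (norm_nonneg x))
    rw [abs_mul, abs_mul, abs_mul, abs_of_nonneg (Real.sqrt_nonneg _)]
    nth_rw 1 [← Real.mul_self_sqrt h0]
    ring
  simp only [e]
  refine ⟨((hmem w hw).integrable_mul (q := 2) (hmem w' hw')).abs,
    (integral_abs_mul_le_sqrt (hmem w hw) (hmem w' hw')).trans ?_⟩
  calc _ ≤ √(C * h1Norm w ^ 2) * √(C * h1Norm w' ^ 2) := by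
        gcongr
        · exact hle w hw
        · exact hle w' hw'
    _ = _ := by
        rw [Real.sqrt_mul hC.le, Real.sqrt_mul hC.le, Real.sqrt_sq (h1Norm_nonneg w),
          Real.sqrt_sq (h1Norm_nonneg w')]
        nth_rw 3 [← Real.mul_self_sqrt hC.le]
        ring

/-- The difference quotient error of a primitive of `f`. -/
noncomputable def primitiveError (f : ℝ → ℝ) (s t : ℝ) : ℝ :=
  ((∫ τ in (0 : ℝ)..t, f τ) - (∫ τ in (0 : ℝ)..s, f τ) - f s * (t - s)) / (t - s)

theorem hasDerivAt_primitive {f : ℝ → ℝ} (hf : Continuous f) (s : ℝ) :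
    HasDerivAt (fun t => ∫ τ in (0 : ℝ)..t, f τ) (f s) s :=
  (hf.integral_hasStrictDerivAt 0 s).hasDerivAt

theorem continuous_primitive {f : ℝ → ℝ} (hf : Continuous f) :
    Continuous fun t => ∫ τ in (0 : ℝ)..t, f τ :=
  continuous_iff_continuousAt.2 fun s => (hasDerivAt_primitive hf s).continuousAt

/-- The identity survives at t = s, where both sides vanish. -/
theorem primitiveError_mul (f : ℝ → ℝ) (s t : ℝ) : primitiveError f s t * (t - s) =
    (∫ τ in (0 : ℝ)..t, f τ) - (∫ τ in (0 : ℝ)..s, f τ) - f s * (t - s) := by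
  by_cases h : t = s
  · simp [h]
  · have : t - s ≠ 0 := sub_ne_zero.2 h
    rw [primitiveError, div_mul_cancel₀ _ this]

theorem tendsto_primitiveError {f : ℝ → ℝ} (hf : Continuous f) (s : ℝ) :
    Tendsto (primitiveError f s) (𝓝 s) (𝓝 0) := by
  have h := (hasDerivAt_primitive hf s).isLittleO.tendsto_div_nhds_zero
  refine h.congr fun t => ?_
  simp [primitiveError, mul_comm]

theorem measurable_primitiveError {f : ℝ → ℝ} (hf : Continuous f) :
    Measurable fun p : ℝ × ℝ => primitiveError f p.1 p.2 := by
  have := continuous_primitive hf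
  unfold primitiveError
  fun_prop

theorem abs_primitiveError_le {f : ℝ → ℝ} (hf : Continuous f) {s t B : ℝ}
    (hB : ∀ τ, |τ| ≤ max |s| |t| → |f τ| ≤ B) : |primitiveError f s t| ≤ 2 * B := by
  have hB0 : 0 ≤ B := (abs_nonneg _).trans (hB s (le_max_left _ _))
  by_cases h : t = s
  · simp only [primitiveError, h, sub_self, div_zero, abs_zero]
    positivity
  have hts : 0 < |t - s| := abs_pos.2 (sub_ne_zero.2 h)
  rw [primitiveError, abs_div, div_le_iff₀ hts,
    intervalIntegral.integral_interval_sub_left (hf.intervalIntegrable _ _)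
      (hf.intervalIntegrable _ _)]
  have h1 : |∫ τ in s..t, f τ| ≤ B * |t - s| := by
    refine intervalIntegral.norm_integral_le_of_norm_le_const (f := f) fun τ hτ => hB τ ?_
    have hτ' := Set.uIoc_subset_uIcc hτ
    rcases Set.mem_uIcc.1 hτ' with h2 | h2
    · exact abs_le_max_abs_abs h2.1 h2.2
    · rw [max_comm]; exact abs_le_max_abs_abs h2.1 h2.2
  have h2 : |f s * (t - s)| ≤ B * |t - s| := by
    rw [abs_mul]
    gcongr
    exact hB s (le_max_left _ _)
  calc _ ≤ |∫ τ in s..t, f τ| + |f s * (t - s)| := abs_sub _ _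
    _ ≤ _ := by linarith

/-- The constants come from (2|s| + |t|)² ≤ 8s² + 2t². Dividing q by √W leaves a bound by squares of
√W s and √W t, which the Hardy inequality integrates. -/
theorem sq_inv_sqrt_mul_le {W C q s t : ℝ} (hW : 0 < W)
    (h : |q| ≤ 2 * (C * (2 * |s| + |t|) * W)) :
    ((√W)⁻¹ * q) ^ 2 ≤ 32 * C ^ 2 * (√W * s) ^ 2 + 8 * C ^ 2 * (√W * t) ^ 2 := by
  rw [mul_pow, mul_pow, mul_pow, inv_pow, Real.sq_sqrt hW.le, inv_mul_le_iff₀ hW]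
  calc q ^ 2 = |q| ^ 2 := (sq_abs _).symm
    _ ≤ (2 * (C * (2 * |s| + |t|) * W)) ^ 2 := by gcongr
    _ = 4 * C ^ 2 * W ^ 2 * (2 * |s| + |t|) ^ 2 := by ring
    _ ≤ 4 * C ^ 2 * W ^ 2 * (8 * |s| ^ 2 + 2 * |t| ^ 2) := by
      gcongr
      nlinarith [sq_nonneg (2 * |s| - |t|)]
    _ = _ := by
      rw [sq_abs, sq_abs]
      ring

section Nemytskii

variable {N : ℕ} {f : ℝ → ℝ}

theorem aestronglyMeasurable_comp_fn (hf : Continuous f) (w : H1 N) :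
    AEStronglyMeasurable (fun x => f (fn w x)) volume :=
  hf.comp_aestronglyMeasurable (memLp_fn w).1

theorem integrable_comp_mul_fn (hN : 2 ≤ N) (h1 : F1 f) (h2 : F2 f) (h3 : F3 N f) {w w' : H1 N}
    (hw : IsRadial w) (hw' : IsRadial w') : Integrable fun x => f (fn w x) * fn w' x := by
  obtain ⟨C, hC, hb⟩ := exists_weighted_linear_bound hN h1 h2 h3 (h1Norm w)
  obtain ⟨C', hC', -, hcs⟩ := exists_weighted_cauchySchwarz hN
  refine ((hcs w w' hw hw').1.const_mul C).mono
    ((aestronglyMeasurable_comp_fn h1.1 w).mul (memLp_fn w').1) ?_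
  filter_upwards [ae_abs_fn_le (by omega) hw, ae_norm_pos (by omega : 1 ≤ N)] with x hx hx0
  have := hb _ hx0 _ (hx.trans_eq (mul_comm _ _))
  refine le_trans ?_ (le_abs_self _)
  rw [norm_mul, Real.norm_eq_abs, Real.norm_eq_abs]
  calc _ ≤ (C * |fn w x| * weight N ‖x‖) * |fn w' x| := by gcongr
    _ = _ := by ring

theorem exists_abs_integral_comp_mul_le (hN : 2 ≤ N) (h1 : F1 f) (h2 : F2 f) (h3 : F3 N f)
    {w : H1 N} (hw : IsRadial w) : ∃ B : ℝ, ∀ w' : H1 N, IsRadial w' →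
      |∫ x, f (fn w x) * fn w' x| ≤ B * h1Norm w' := by
  obtain ⟨C, hC, hb⟩ := exists_weighted_linear_bound hN h1 h2 h3 (h1Norm w)
  obtain ⟨C', hC', -, hcs⟩ := exists_weighted_cauchySchwarz hN
  refine ⟨C * (C' * h1Norm w), fun w' hw' => ?_⟩
  have h := hcs w w' hw hw'
  calc |∫ x, f (fn w x) * fn w' x| ≤ ∫ x, |f (fn w x) * fn w' x| := abs_integral_le_integral_abs
    _ ≤ ∫ x, C * (weight N ‖x‖ * |fn w x| * |fn w' x|) := by
      refine integral_mono_ae (integrable_comp_mul_fn hN h1 h2 h3 hw hw').abs (h.1.const_mul C) ?_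
      filter_upwards [ae_abs_fn_le (by omega) hw, ae_norm_pos (by omega : 1 ≤ N)] with x hx hx0
      have := hb _ hx0 _ (hx.trans_eq (mul_comm _ _))
      rw [abs_mul]
      calc _ ≤ (C * |fn w x| * weight N ‖x‖) * |fn w' x| := by gcongr
        _ = _ := by ring
    _ ≤ C * (C' * h1Norm w * h1Norm w') := by
      rw [integral_const_mul]
      gcongr
      exact h.2
    _ = _ := by ring

theorem integrable_primitive_fn (hN : 2 ≤ N) (h1 : F1 f) (h2 : F2 f) (h3 : F3 N f) {w : H1 N}
    (hw : IsRadial w) : Integrable fun x => ∫ τ in (0 : ℝ)..fn w x, f τ := by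
  obtain ⟨C, hC, hb⟩ := exists_weighted_linear_bound hN h1 h2 h3 (h1Norm w)
  obtain ⟨C', hC', -, hcs⟩ := exists_weighted_cauchySchwarz hN
  refine ((hcs w w hw hw).1.const_mul C).mono
    ((continuous_primitive h1.1).comp_aestronglyMeasurable (memLp_fn w).1) ?_
  filter_upwards [ae_abs_fn_le (by omega) hw, ae_norm_pos (by omega : 1 ≤ N)] with x hx hx0
  have hW := zero_le_one.trans (one_le_weight N hx0.le)
  refine le_trans ?_ (le_abs_self _)
  have h : ‖∫ τ in (0 : ℝ)..fn w x, f τ‖ ≤ (C * |fn w x| * weight N ‖x‖) * |fn w x - 0| := by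
    refine intervalIntegral.norm_integral_le_of_norm_le_const fun τ hτ => ?_
    have hτ' : |τ| ≤ |fn w x| := by
      have := Set.uIoc_subset_uIcc hτ
      rcases Set.mem_uIcc.1 this with h2 | h2
      · rw [abs_of_nonneg h2.1]; exact h2.2.trans (le_abs_self _)
      · rw [abs_of_nonpos h2.2]; exact (neg_le_neg h2.1).trans (neg_le_abs _)
    have := hb _ hx0 τ (hτ'.trans (hx.trans_eq (mul_comm _ _)))
    calc _ ≤ C * |τ| * weight N ‖x‖ := this
      _ ≤ _ := by gcongr
  calc _ ≤ _ := h
    _ = _ := by rw [sub_zero]; ring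

/-- The functional `u ↦ ∫ F(u)` is differentiable along sequences of radial functions. -/
theorem exists_remainder_bound (hN : 2 ≤ N) (h1 : F1 f) (h2 : F2 f) (h3 : F3 N f) {u : H1 N}
    (hu : IsRadial u) {y h : ℕ → H1 N} (hy : ∀ n, IsRadial (y n)) (hh : ∀ n, IsRadial (h n))
    (hyh : ∀ n, fn (y n) =ᵐ[volume] fun x => fn u x + fn (h n) x)
    (hlim : Tendsto (fun n => h1Norm (h n)) atTop (𝓝 0)) :
    ∃ c : ℕ → ℝ, Tendsto c atTop (𝓝 0) ∧ ∀ n,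
      |(∫ x, ∫ τ in (0 : ℝ)..fn (y n) x, f τ) - (∫ x, ∫ τ in (0 : ℝ)..fn u x, f τ)
        - ∫ x, f (fn u x) * fn (h n) x| ≤ c n * h1Norm (h n) := by
  have hN1 : 1 ≤ N := by omega
  obtain ⟨A, hA⟩ : ∃ A, ∀ n, h1Norm (h n) ≤ A := by
    obtain ⟨A, hA⟩ := hlim.bddAbove_range
    exact ⟨A, fun n => hA ⟨n, rfl⟩⟩
  obtain ⟨C, hC, hb⟩ := exists_weighted_linear_bound hN h1 h2 h3 (A + h1Norm u)
  obtain ⟨C', hC', hmem, -⟩ := exists_weighted_cauchySchwarz hN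
  have hae : ∀ᵐ x : Space N, 0 < ‖x‖ ∧ |fn u x| ≤ radialBound N ‖x‖ * h1Norm u ∧
      ∀ n, fn (y n) x = fn u x + fn (h n) x ∧
        |fn (h n) x| ≤ radialBound N ‖x‖ * h1Norm (h n) := by
    filter_upwards [ae_norm_pos hN1, ae_abs_fn_le hN1 hu,
      ae_all_iff.2 hyh, ae_all_iff.2 fun n => ae_abs_fn_le hN1 (hh n)]
      with x a b c d using ⟨a, b, fun n => ⟨c n, d n⟩⟩
  obtain ⟨q, hq⟩ : ∃ q : ℕ → Space N → ℝ,
    q = fun n x => primitiveError f (fn u x) (fn (y n) x) := ⟨_, rfl⟩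
  have hqm : ∀ n, AEStronglyMeasurable (q n) volume := fun n => by
    rw [hq]
    exact ((measurable_primitiveError h1.1).comp_aemeasurable
      ((memLp_fn u).1.aemeasurable.prodMk (memLp_fn (y n)).1.aemeasurable)).aestronglyMeasurable
  have hqb : ∀ᵐ x : Space N, ∀ n, |q n x| ≤
      2 * (C * (2 * |fn u x| + |fn (h n) x|) * weight N ‖x‖) := by
    filter_upwards [hae] with x hx n
    rw [hq]
    refine abs_primitiveError_le h1.1 fun τ hτ => ?_
    have hW := zero_le_one.trans (one_le_weight N hx.1.le)
    have e : |fn (y n) x| ≤ |fn u x| + |fn (h n) x| := by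
      rw [(hx.2.2 n).1]
      exact abs_add_le _ _
    have hτ1 : |τ| ≤ |fn u x| + |fn (h n) x| :=
      hτ.trans (max_le (by linarith [abs_nonneg (fn (h n) x)]) e)
    have hτ2 : |τ| ≤ (A + h1Norm u) * radialBound N ‖x‖ := by
      have h4 := (hx.2.2 n).2.trans (mul_le_mul_of_nonneg_left (hA n) (radialBound_nonneg N ‖x‖))
      linarith [hx.2.1]
    refine (hb _ hx.1 τ hτ2).trans ?_
    gcongr
    linarith [abs_nonneg (fn u x)]
  -- The remainder integrand q h is split as (W^{−1/2} q)(W^{1/2} h). By Cauchy–Schwarz the second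
  -- factor costs ‖h‖, so it suffices that the first tends to 0 in L², which follows from
  -- `tendsto_integral_of_le_add`.
  obtain ⟨P, hP⟩ : ∃ P : ℕ → Space N → ℝ, P = fun n x => (√(weight N ‖x‖))⁻¹ * q n x := ⟨_, rfl⟩
  have hPm : ∀ n, AEStronglyMeasurable (P n) volume := fun n => by
    rw [hP]
    exact ((measurable_weight N).comp measurable_norm).sqrt.inv.aestronglyMeasurable.mul (hqm n)
  obtain ⟨V, hV⟩ : ∃ V : H1 N → Space N → ℝ, V = fun w x => (√(weight N ‖x‖) * fn w x) ^ 2 :=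
    ⟨_, rfl⟩
  have hVi : ∀ w, IsRadial w → Integrable (V w) := fun w hw => by
    rw [hV]; exact (hmem w hw).1.integrable_sq
  have hPb : ∀ᵐ x : Space N, ∀ n, P n x ^ 2 ≤
      32 * C ^ 2 * V u x + 8 * C ^ 2 * V (h n) x := by
    filter_upwards [hqb, ae_norm_pos hN1] with x hx hx0 n
    have hW := one_pos.trans_le (one_le_weight N hx0.le)
    simp only [hP, hV]
    exact sq_inv_sqrt_mul_le hW (hx n)
  have hPi : ∀ n, Integrable fun x => P n x ^ 2 := fun n => by
    refine (((hVi u hu).const_mul (32 * C ^ 2)).add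
      ((hVi _ (hh n)).const_mul (8 * C ^ 2))).mono ((hPm n).pow 2) ?_
    filter_upwards [hPb] with x hx
    rw [Real.norm_of_nonneg (sq_nonneg _)]
    exact (hx n).trans (le_abs_self _)
  have hPlim : ∀ᵐ x : Space N, Tendsto (fun n => P n x ^ 2) atTop (𝓝 0) := by
    filter_upwards [hae] with x hx
    have h4 : Tendsto (fun n => fn (h n) x) atTop (𝓝 0) := by
      refine squeeze_zero_norm (fun n => (hx.2.2 n).2) ?_
      simpa using hlim.const_mul (radialBound N ‖x‖)
    have h5 : Tendsto (fun n => fn (y n) x) atTop (𝓝 (fn u x)) := by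
      have := h4.const_add (fn u x)
      rw [add_zero] at this
      exact this.congr fun n => (hx.2.2 n).1.symm
    have h6 := (((tendsto_primitiveError h1.1 (fn u x)).comp h5).const_mul
      (√(weight N ‖x‖))⁻¹).pow 2
    rw [hP, hq]
    simpa using h6
  have hVlim : Tendsto (fun n => ∫ x, 8 * C ^ 2 * V (h n) x) atTop (𝓝 0) := by
    refine squeeze_zero (g := fun n => 8 * C ^ 2 * (C' * h1Norm (h n) ^ 2))
      (fun n => integral_nonneg fun x => ?_) (fun n => ?_) ?_
    · simp only [hV, Pi.zero_apply]; positivity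
    · rw [integral_const_mul]
      gcongr
      rw [hV]
      exact (hmem _ (hh n)).2
    · simpa using ((hlim.pow 2).const_mul C').const_mul (8 * C ^ 2)
  have hlim2 : Tendsto (fun n => ∫ x, P n x ^ 2) atTop (𝓝 0) :=
    tendsto_integral_of_le_add hPi (fun n => .of_forall fun x => sq_nonneg _)
      ((hVi u hu).const_mul _) (fun n => (hVi _ (hh n)).const_mul _)
      (fun n => .of_forall fun x => by simp only [hV]; positivity)
      (fun n => hPb.mono fun x hx => hx n) hPlim hVlim
  refine ⟨fun n => √(∫ x, P n x ^ 2) * √C', ?_, fun n => ?_⟩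
  · have := (hlim2.sqrt).mul_const √C'
    simpa using this
  have hPmem : MemLp (P n) 2 volume := (memLp_two_iff_integrable_sq (hPm n)).2 (hPi n)
  have hi1 := integrable_primitive_fn hN h1 h2 h3 (hy n)
  have hi2 := integrable_primitive_fn hN h1 h2 h3 hu
  have hi3 := integrable_comp_mul_fn hN h1 h2 h3 hu (hh n)
  have e0 := integral_sub (hi1.sub hi2) hi3
  simp only [Pi.sub_apply] at e0
  rw [integral_sub hi1 hi2] at e0
  rw [← e0]
  have e : ∀ᵐ x : Space N, (∫ τ in (0 : ℝ)..fn (y n) x, f τ) - (∫ τ in (0 : ℝ)..fn u x, f τ)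
      - f (fn u x) * fn (h n) x = P n x * (√(weight N ‖x‖) * fn (h n) x) := by
    filter_upwards [hae] with x hx
    have hW := Real.sqrt_pos.2 (one_pos.trans_le (one_le_weight N hx.1.le))
    have hd : fn (h n) x = fn (y n) x - fn u x := by rw [(hx.2.2 n).1]; ring
    rw [hd, ← primitiveError_mul, hP, hq]
    field_simp
  calc _ = |∫ x, P n x * (√(weight N ‖x‖) * fn (h n) x)| := by
        congr 1
        exact integral_congr_ae e
    _ ≤ ∫ x, |P n x * (√(weight N ‖x‖) * fn (h n) x)| := abs_integral_le_integral_abs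
    _ ≤ √(∫ x, P n x ^ 2) * √(∫ x, (√(weight N ‖x‖) * fn (h n) x) ^ 2) :=
        integral_abs_mul_le_sqrt hPmem (hmem _ (hh n)).1
    _ ≤ √(∫ x, P n x ^ 2) * √(C' * h1Norm (h n) ^ 2) := by
        gcongr
        exact (hmem _ (hh n)).2
    _ = _ := by
        rw [Real.sqrt_mul hC'.le, Real.sqrt_sq (h1Norm_nonneg _)]
        ring

end Nemytskii


end Kirchhoff

/-! ### The derivative of the functional. -/

namespace Kirchhoff

/-- A sequential criterion for Fréchet differentiability of a functional. -/
theorem hasFDerivAt_of_seq {E : Type*} [NormedAddCommGroup E] [NormedSpace ℝ E] {I : E → ℝ}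
    {L : E →L[ℝ] ℝ} {u : E} (h : ∀ y : ℕ → E, Tendsto (fun n => ‖y n - u‖) atTop (𝓝 0) →
      ∃ c : ℕ → ℝ, Tendsto c atTop (𝓝 0) ∧
        ∀ n, |I (y n) - I u - L (y n - u)| ≤ c n * ‖y n - u‖) : HasFDerivAt I L u := by
  rw [hasFDerivAt_iff_tendsto]
  refine tendsto_of_seq_tendsto fun y hy => ?_
  obtain ⟨c, hc, hb⟩ := h y (tendsto_iff_norm_sub_tendsto_zero.1 hy)
  refine squeeze_zero (g := fun n => |c n|) (fun n => ?_) (fun n => ?_) (by simpa using hc.abs)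
  · dsimp only [Function.comp]
    positivity
  dsimp only [Function.comp]
  rw [Real.norm_eq_abs]
  have hn : 0 ≤ ‖y n - u‖ := norm_nonneg _
  calc _ ≤ ‖y n - u‖⁻¹ * (|c n| * ‖y n - u‖) := by
        gcongr
        exact (hb n).trans (by gcongr; exact le_abs_self _)
    _ ≤ |c n| := by
        rcases hn.eq_or_lt with h0 | h0
        · rw [← h0]; simp
        · rw [mul_comm, mul_assoc, mul_inv_cancel₀ h0.ne', mul_one]

/-- The weak gradient as a continuous linear map. -/
noncomputable def gradL (N : ℕ) : H1 N →L[ℝ] Lp (Space N) 2 (volume : Measure (Space N)) :=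
  (WithLp.sndL 2 ℝ _ _).comp (H1 N).subtypeL

theorem norm_gradL_sq {N : ℕ} (w : H1 N) : ‖gradL N w‖ ^ 2 = ∫ x, ‖grad w x‖ ^ 2 :=
  norm_snd_sq w

variable {N : ℕ} {f : ℝ → ℝ} {X : Type*} [NormedAddCommGroup X] [NormedSpace ℝ X]
  {ι : X →ₗᵢ[ℝ] H1 N}

theorem integral_mul_fn_add {p : Space N → ℝ} {w w' : H1 N}
    (hw : Integrable fun x => p x * fn w x) (hw' : Integrable fun x => p x * fn w' x) :
    ∫ x, p x * fn (w + w') x = (∫ x, p x * fn w x) + ∫ x, p x * fn w' x := by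
  rw [← integral_add hw hw']
  refine integral_congr_ae ?_
  filter_upwards [fn_add w w'] with x hx
  rw [hx, mul_add]

theorem integral_mul_fn_smul (p : Space N → ℝ) (c : ℝ) (w : H1 N) :
    ∫ x, p x * fn (c • w) x = c * ∫ x, p x * fn w x := by
  rw [← integral_const_mul]
  refine integral_congr_ae ?_
  filter_upwards [fn_smul c w] with x hx
  rw [hx, mul_left_comm]

theorem exists_force_functional (hN : 2 ≤ N) (h1 : F1 f) (h2 : F2 f) (h3 : F3 N f)
    (hι : ∀ x, IsRadial (ι x)) (u : X) :
    ∃ L : X →L[ℝ] ℝ, ∀ h : X, L h = ∫ x, f (fn (ι u) x) * fn (ι h) x :=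
  have ⟨B, hB⟩ := exists_abs_integral_comp_mul_le hN h1 h2 h3 (hι u)
  have hi := fun h : X => integrable_comp_mul_fn hN h1 h2 h3 (hι u) (hι h)
  ⟨LinearMap.mkContinuous
    { toFun := fun h => ∫ x, f (fn (ι u) x) * fn (ι h) x
      map_add' := fun h h' => (congrArg (fun w => ∫ x, f (fn (ι u) x) * fn w x)
        (ι.map_add h h')).trans (integral_mul_fn_add (hi h) (hi h'))
      map_smul' := fun c h => (congrArg (fun w => ∫ x, f (fn (ι u) x) * fn w x)
        (ι.map_smul c h)).trans (integral_mul_fn_smul _ c (ι h)) } B fun h =>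
        (hB (ι h) (hι h)).trans_eq (congrArg (B * ·) (ι.norm_map h)), fun _ => rfl⟩

theorem hasFDerivAt_potential (hN : 2 ≤ N) (h1 : F1 f) (h2 : F2 f) (h3 : F3 N f)
    (hι : ∀ x, IsRadial (ι x)) {u : X}
    {L : X →L[ℝ] ℝ} (hL : ∀ h : X, L h = ∫ x, f (fn (ι u) x) * fn (ι h) x) :
    HasFDerivAt (fun w : X => ∫ x, ∫ τ in (0 : ℝ)..fn (ι w) x, f τ) L u := by
  refine hasFDerivAt_of_seq fun y hy => ?_
  have hnorm : ∀ n, h1Norm (ι (y n - u)) = ‖y n - u‖ := fun n => ι.norm_map _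
  obtain ⟨c, hc, hb⟩ := exists_remainder_bound hN h1 h2 h3 (hι u)
    (y := fun n => ι (y n)) (h := fun n => ι (y n - u)) (fun n => hι _) (fun n => hι _)
    (fun n => by
      filter_upwards [fn_sub (ι (y n)) (ι u)] with x hx
      rw [map_sub, hx]
      ring) (by simpa only [hnorm] using hy)
  refine ⟨c, hc, fun n => ?_⟩
  rw [hL, ← hnorm]
  exact hb n

/-- The functional `Φ` pulled back along a linear isometry into `H¹`. -/
noncomputable def pullbackEnergy (a b : ℝ) (f : ℝ → ℝ) (ι : X →ₗᵢ[ℝ] H1 N) (u : X) : ℝ :=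
  1 / 2 * a * (∫ x, ‖grad (ι u) x‖ ^ 2) + 1 / 4 * b * (∫ x, ‖grad (ι u) x‖ ^ 2) ^ 2
    - ∫ x, ∫ τ in (0 : ℝ)..fn (ι u) x, f τ

/-- The gradient part is the polynomial a s/2 + b s²/4 at s = ‖∇w‖². Without this lemma the
Palais–Smale hypothesis could hold vacuously, `fderiv` being 0 at points of non-differentiability.
-/
theorem hasFDerivAt_pullbackEnergy (hN : 2 ≤ N) (a b : ℝ) (h1 : F1 f) (h2 : F2 f) (h3 : F3 N f)
    (hι : ∀ x, IsRadial (ι x)) {u : X}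
    {L : X →L[ℝ] ℝ} (hL : ∀ h : X, L h = ∫ x, f (fn (ι u) x) * fn (ι h) x)
    {G : X →L[ℝ] Lp (Space N) 2 (volume : Measure (Space N))} (hG : ∀ x, G x = gradL N (ι x)) :
    HasFDerivAt (pullbackEnergy a b f ι)
      ((a + b * ‖G u‖ ^ 2) • (innerSL ℝ (G u)).comp G - L) u := by
  have hd : HasFDerivAt (fun w : X => ‖G w‖ ^ 2) (2 • (innerSL ℝ (G u)).comp G) u :=
    G.hasFDerivAt.norm_sq
  have hE : pullbackEnergy a b f ι = fun w => (1 / 2 * a * ‖G w‖ ^ 2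
      + 1 / 4 * b * (‖G w‖ ^ 2) ^ 2) - ∫ x, ∫ τ in (0 : ℝ)..fn (ι w) x, f τ := by
    funext w
    rw [hG, norm_gradL_sq]
    rfl
  rw [hE]
  have hp : HasDerivAt (fun s : ℝ => 1 / 2 * a * s + 1 / 4 * b * s ^ 2)
      (1 / 2 * a + 1 / 2 * b * ‖G u‖ ^ 2) (‖G u‖ ^ 2) := by
    have h4 := ((hasDerivAt_id (‖G u‖ ^ 2)).const_mul (1 / 2 * a)).add
      ((hasDerivAt_pow 2 (‖G u‖ ^ 2)).const_mul (1 / 4 * b))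
    refine h4.congr_deriv ?_
    push_cast
    ring
  have h5 := (hp.comp_hasFDerivAt u hd).sub (hasFDerivAt_potential hN h1 h2 h3 hι hL)
  refine h5.congr_fderiv ?_
  ext h
  simp
  ring


end Kirchhoff

/-! ### Weak limits of radial functions. -/

namespace Kirchhoff

/-- Sequential Banach–Alaoglu in the dual, carried back by the Riesz isomorphism. -/
theorem exists_weakly_convergent_subseq {E : Type*} [NormedAddCommGroup E] [InnerProductSpace ℝ E]
    [CompleteSpace E] [TopologicalSpace.SeparableSpace E] {x : ℕ → E} {A : ℝ}
    (hx : ∀ n, ‖x n‖ ≤ A) : ∃ (e : E) (k : ℕ → ℕ), StrictMono k ∧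
      ∀ z, Tendsto (fun n => ⟪x (k n), z⟫) atTop (𝓝 ⟪e, z⟫) := by
  have hc := WeakDual.isSeqCompact_closedBall ℝ E 0 A
  obtain ⟨e', -, k, hk, hlim⟩ := hc
    (x := fun n => StrongDual.toWeakDual (InnerProductSpace.toDual ℝ E (x n))) fun n => by
      simpa using hx n
  refine ⟨(InnerProductSpace.toDual ℝ E).symm (WeakDual.toStrongDual e'), k, hk, fun z => ?_⟩
  have h := ((WeakDual.eval_continuous z).tendsto e').comp hlim
  rw [InnerProductSpace.toDual_symm_apply]
  exact h

/-- A closed subspace is its double orthogonal complement, and each condition ⟨x, z⟩ = 0 passes to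
weak limits. -/
theorem mem_of_weak_limit {E : Type*} [NormedAddCommGroup E] [InnerProductSpace ℝ E]
    [CompleteSpace E] {V : Submodule ℝ E} (hV : IsClosed (V : Set E)) {x : ℕ → E} {e : E}
    (hx : ∀ n, x n ∈ V) (hlim : ∀ z, Tendsto (fun n => ⟪x n, z⟫) atTop (𝓝 ⟪e, z⟫)) : e ∈ V := by
  have : V = Vᗮᗮ := by
    rw [Submodule.orthogonal_orthogonal_eq_closure]
    exact hV.submodule_topologicalClosure_eq.symm
  rw [this, Submodule.mem_orthogonal]
  intro z hz
  have h := hlim z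
  have h0 : (fun n => ⟪x n, z⟫) = fun _ => (0 : ℝ) := by
    funext n
    exact (Submodule.mem_orthogonal V z).1 hz _ (hx n)
  rw [h0] at h
  rw [real_inner_comm]
  exact (tendsto_nhds_unique h tendsto_const_nhds)

/-- The Hilbert space containing `H¹(ℝ^N)`. -/
abbrev Ambient (N : ℕ) : Type :=
  WithLp 2 (Lp ℝ 2 (volume : Measure (Space N)) × Lp (Space N) 2 (volume : Measure (Space N)))

variable {N : ℕ}

/-- Membership becomes orthogonality to fixed vectors of L² × L², one for each test function and
direction, so that closedness is evident. -/
theorem isWeakGradient_iff (w : Ambient N) : w ∈ H1 N ↔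
    ∀ φ : Space N → ℝ, ∀ hφ : ContDiff ℝ ∞ φ, ∀ hc : HasCompactSupport φ, ∀ v : Space N,
      ⟪((hφ.continuous_fderiv (by simp)).clm_apply continuous_const).memLp_of_hasCompactSupport
          (p := 2) (μ := volume) (hc.fderiv_apply (𝕜 := ℝ) v) |>.toLp _, w.fst⟫
        + ⟪((hφ.continuous.smul (continuous_const (y := v))).memLp_of_hasCompactSupport
          (p := 2) (μ := volume) hc.smul_right).toLp _, w.snd⟫ = (0 : ℝ) := by
  have h : w ∈ H1 N ↔ IsWeakGradient (w.fst : Space N → ℝ) (w.snd : Space N → Space N) := Iff.rfl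
  rw [h, IsWeakGradient]
  refine forall_congr' fun φ => forall_congr' fun hφ => forall_congr' fun hc =>
    forall_congr' fun v => ?_
  rw [L2.inner_def, L2.inner_def, ← eq_neg_iff_add_eq_zero]
  refine Eq.congr ?_ (congrArg Neg.neg ?_)
  · refine integral_congr_ae ?_
    filter_upwards [MemLp.coeFn_toLp (((hφ.continuous_fderiv (by simp)).clm_apply
      continuous_const).memLp_of_hasCompactSupport (p := 2) (μ := volume)
        (hc.fderiv_apply (𝕜 := ℝ) v))] with x hx
    rw [hx]
    simp
  · refine integral_congr_ae ?_
    filter_upwards [MemLp.coeFn_toLp ((hφ.continuous.smul (continuous_const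
      (y := v))).memLp_of_hasCompactSupport (p := 2) (μ := volume) hc.smul_right)] with x hx
    rw [hx, Pi.smul_apply', real_inner_smul_left, real_inner_comm, mul_comm]

theorem isClosed_H1 : IsClosed (H1 N : Set (Ambient N)) := by
  have : (H1 N : Set (Ambient N)) = {w | w ∈ H1 N} := rfl
  rw [this]
  simp only [isWeakGradient_iff, Set.ofPred_forall]
  refine isClosed_iInter fun φ => isClosed_iInter fun hφ => isClosed_iInter fun hc =>
    isClosed_iInter fun v => isClosed_eq ?_ continuous_const
  exact (continuous_const.inner (WithLp.sndL 2 ℝ _ _ : Ambient N →L[ℝ] _).continuous |> fun h2 =>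
    (continuous_const.inner (WithLp.fstL 2 ℝ _ _ : Ambient N →L[ℝ] _).continuous).add h2)

/-- The radial elements of `L²(ℝ^N)` form a closed set. -/
theorem isClosed_radial_Lp : IsClosed {u : Lp ℝ 2 (volume : Measure (Space N)) |
    ∃ ρ : ℝ → ℝ, (u : Space N → ℝ) =ᵐ[volume] fun x => ρ ‖x‖} := by
  refine IsSeqClosed.isClosed fun u v hu hv => ?_
  choose ρ hρ using hu
  have h1 := tendstoInMeasure_of_tendsto_Lp hv
  obtain ⟨k, -, hk⟩ := h1.exists_seq_tendsto_ae
  -- Along an almost everywhere convergent subsequence the pointwise limit of the profiles is a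
  -- profile of the limit; radii without a limit carry an arbitrary value and do not matter.
  refine ⟨fun r => limUnder atTop fun n => ρ (k n) r, ?_⟩
  filter_upwards [hk, ae_all_iff.2 hρ] with x hx hx'
  refine (Tendsto.limUnder_eq ?_).symm
  exact hx.congr fun n => hx' (k n)

theorem isClosed_map_H1r : IsClosed (((H1r N).map (H1 N).subtype : Submodule ℝ (Ambient N)) :
    Set (Ambient N)) := by
  have : (((H1r N).map (H1 N).subtype : Submodule ℝ (Ambient N)) : Set (Ambient N)) =
      (H1 N : Set (Ambient N)) ∩ (WithLp.fstL 2 ℝ _ _ : Ambient N →L[ℝ] _) ⁻¹'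
        {u : Lp ℝ 2 (volume : Measure (Space N)) |
          ∃ ρ : ℝ → ℝ, (u : Space N → ℝ) =ᵐ[volume] fun x => ρ ‖x‖} := by
    ext w
    constructor
    · rintro ⟨w', hw', rfl⟩
      exact ⟨w'.2, hw'⟩
    · rintro ⟨h1, h2⟩
      exact ⟨⟨w, h1⟩, h2, rfl⟩
  rw [this]
  exact isClosed_H1.inter (isClosed_radial_Lp.preimage (ContinuousLinearMap.continuous _))

theorem separableSpace_ambient : TopologicalSpace.SeparableSpace (Ambient N) :=
  have : Fact ((2 : ENNReal) ≠ ⊤) := ⟨by simp⟩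
  have : SecondCountableTopology (Lp ℝ 2 (volume : Measure (Space N))) := inferInstance
  have : SecondCountableTopology (Lp (Space N) 2 (volume : Measure (Space N))) := inferInstance
  have : TopologicalSpace.SeparableSpace (Lp ℝ 2 (volume : Measure (Space N))) := inferInstance
  have : TopologicalSpace.SeparableSpace (Lp (Space N) 2 (volume : Measure (Space N))) :=
    inferInstance
  have : TopologicalSpace.SeparableSpace (Lp ℝ 2 (volume : Measure (Space N)) ×
    Lp (Space N) 2 (volume : Measure (Space N))) := inferInstance
  (WithLp.homeomorphProd 2 (Lp ℝ 2 (volume : Measure (Space N)))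
    (Lp (Space N) 2 (volume : Measure (Space N)))).symm.surjective.denseRange.separableSpace
    (Homeomorph.continuous _)

/-- Bounded sequences of radial functions have subsequences converging weakly to a radial
function. -/
theorem exists_radial_weak_limit {w : ℕ → H1 N} (hw : ∀ n, IsRadial (w n)) {A : ℝ}
    (hA : ∀ n, h1Norm (w n) ≤ A) : ∃ (v : H1 N) (k : ℕ → ℕ), IsRadial v ∧ StrictMono k ∧
      ∀ z : Ambient N, Tendsto (fun n => ⟪(w (k n)).1, z⟫) atTop (𝓝 ⟪v.1, z⟫) := by
  have := separableSpace_ambient (N := N)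
  obtain ⟨e, k, hk, hlim⟩ := exists_weakly_convergent_subseq (x := fun n => (w n).1) hA
  obtain ⟨v, hv, rfl⟩ := mem_of_weak_limit isClosed_map_H1r
    (fun n => ⟨w (k n), hw (k n), rfl⟩) hlim
  exact ⟨v, k, hv, hk, hlim⟩


end Kirchhoff

/-! ### The upper limit of the nonlinear term. -/

namespace Kirchhoff

variable {N : ℕ} {f : ℝ → ℝ}

theorem exists_tail_integral_lt (v : H1 N) {η : ℝ} (hη : 0 < η) :
    ∃ R₀ : ℝ, ∀ R ≥ R₀, ∫ x in (Metric.ball (0 : Space N) R)ᶜ, fn v x ^ 2 < η := by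
  have h := tendsto_setIntegral_of_antitone (μ := (volume : Measure (Space N)))
    (f := fun x => fn v x ^ 2) (s := fun n : ℕ => (Metric.ball (0 : Space N) n)ᶜ)
    (fun n => measurableSet_ball.compl)
    (fun n m hnm => Set.compl_subset_compl.2 (Metric.ball_subset_ball (by exact_mod_cast hnm)))
    ⟨0, (integrable_fn_sq v).integrableOn⟩
  have he : ⋂ n : ℕ, (Metric.ball (0 : Space N) (n : ℝ))ᶜ = ∅ := by
    rw [← Set.compl_iUnion, Metric.iUnion_ball_nat, Set.compl_univ]
  rw [he, setIntegral_empty] at h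
  obtain ⟨n, hn⟩ := (h.eventually (gt_mem_nhds hη)).exists
  refine ⟨n, fun R hR => lt_of_le_of_lt ?_ hn⟩
  exact setIntegral_mono_set (integrable_fn_sq v).integrableOn
    (.of_forall fun x => sq_nonneg _)
    (Set.compl_subset_compl.2 (Metric.ball_subset_ball hR)).eventuallyLE

/-- On balls, bounded sequences of radial functions that converge almost everywhere to zero do so
in the mean. -/
theorem tendsto_integral_ball (hN : 2 ≤ N) {w d : ℕ → H1 N}
    (hw : ∀ n, IsRadial (w n)) (hd : ∀ n, IsRadial (d n)) {A : ℝ} (hwA : ∀ n, h1Norm (w n) ≤ A)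
    (hdA : ∀ n, h1Norm (d n) ≤ A) (hlim : ∀ᵐ x, Tendsto (fun n => fn (d n) x) atTop (𝓝 0))
    {D m : ℝ} (hD : 0 ≤ D) (hm : 0 ≤ m) (R : ℝ) :
    (∀ n, IntegrableOn (fun x => (D + m * |fn (w n) x|) * |fn (d n) x|)
      (Metric.ball (0 : Space N) R)) ∧
    Tendsto (fun n => ∫ x in Metric.ball (0 : Space N) R,
      (D + m * |fn (w n) x|) * |fn (d n) x|) atTop (𝓝 0) := by
  have hN1 : 1 ≤ N := by omega
  have hA : 0 ≤ A := (h1Norm_nonneg (w 0)).trans (hwA 0)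
  have hσ := sphereArea_pos hN1
  have hmeas : ∀ n, AEStronglyMeasurable (fun x => (D + m * |fn (w n) x|) * |fn (d n) x|)
      (volume.restrict (Metric.ball (0 : Space N) R)) := fun n =>
    ((((memLp_fn (w n)).1.norm.const_mul m).const_add D).mul (memLp_fn (d n)).1.norm).restrict
  -- The majorant comes from |w|, |d| ≤ A K with K ≤ 1 + K² and K² ≤ (2/σ)|x|^{1−N}, where K is
  -- `radialBound` and σ is `sphereArea`.
  have hgi : IntegrableOn (fun x : Space N => D * A + (D * A + m * A ^ 2) *
      (2 / sphereArea N * (‖x‖ ^ (N - 1))⁻¹)) (Metric.ball 0 R) :=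
    (integrableOn_const (by exact measure_ball_lt_top.ne)).add
      (((integrableOn_inv_norm_pow hN1 R).const_mul _).const_mul _)
  have hle : ∀ᵐ x : Space N, ∀ n, ‖(D + m * |fn (w n) x|) * |fn (d n) x|‖ ≤
      D * A + (D * A + m * A ^ 2) * (2 / sphereArea N * (‖x‖ ^ (N - 1))⁻¹) := by
    filter_upwards [ae_norm_pos hN1, ae_all_iff.2 fun n => ae_abs_fn_le hN1 (hw n),
      ae_all_iff.2 fun n => ae_abs_fn_le hN1 (hd n)] with x hx h1 h2 n
    have hK := radialBound_nonneg N ‖x‖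
    have hK2 := radialBound_sq_le hN1 hx
    have h3 : |fn (w n) x| ≤ radialBound N ‖x‖ * A :=
      (h1 n).trans (mul_le_mul_of_nonneg_left (hwA n) hK)
    have h4 : |fn (d n) x| ≤ radialBound N ‖x‖ * A :=
      (h2 n).trans (mul_le_mul_of_nonneg_left (hdA n) hK)
    rw [Real.norm_of_nonneg (by positivity)]
    calc _ ≤ (D + m * (radialBound N ‖x‖ * A)) * (radialBound N ‖x‖ * A) := by gcongr
      _ = D * A * radialBound N ‖x‖ + m * A ^ 2 * radialBound N ‖x‖ ^ 2 := by ring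
      _ ≤ D * A * (1 + radialBound N ‖x‖ ^ 2) + m * A ^ 2 * radialBound N ‖x‖ ^ 2 := by
        gcongr
        nlinarith [sq_nonneg (radialBound N ‖x‖ - 1)]
      _ = D * A + (D * A + m * A ^ 2) * radialBound N ‖x‖ ^ 2 := by ring
      _ ≤ _ := by gcongr
  refine ⟨fun n => hgi.mono' (hmeas n) (ae_restrict_of_ae (hle.mono fun x hx => hx n)), ?_⟩
  have h := tendsto_integral_of_dominated_convergence
    (μ := volume.restrict (Metric.ball (0 : Space N) R)) _ hmeas hgi
    (fun n => ae_restrict_of_ae (hle.mono fun x hx => hx n)) (f := fun _ => (0 : ℝ))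
    (ae_restrict_of_ae ?_)
  · simpa using h
  · filter_upwards [hlim, ae_norm_pos hN1, ae_all_iff.2 fun n => ae_abs_fn_le hN1 (hw n)]
      with x hx hx0 h1
    refine squeeze_zero (g := fun n => (D + m * (radialBound N ‖x‖ * A)) * |fn (d n) x|)
      (fun n => by positivity) (fun n => ?_) (by simpa using hx.abs.const_mul _)
    have := (h1 n).trans (mul_le_mul_of_nonneg_left (hwA n) (radialBound_nonneg N ‖x‖))
    gcongr

/-- The nonlinear term, with its negative linear part removed, has nonpositive upper limit along
weakly null increments. -/
theorem eventually_integral_nonlinear_le (hN : 2 ≤ N) (h1 : F1 f) (h3 : F3 N f)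
    {m M δ : ℝ} (hm : 0 < m) (hM : 0 ≤ M) (hδ : 0 < δ)
    (hf : ∀ t, |t| ≤ δ → f t * t ≤ -m * t ^ 2 ∧ |f t| ≤ M * |t|)
    {v : H1 N} {w d : ℕ → H1 N}
    (hw : ∀ n, IsRadial (w n)) (hd : ∀ n, IsRadial (d n))
    (hwd : ∀ n, fn (w n) =ᵐ[volume] fun x => fn v x + fn (d n) x)
    {A : ℝ} (hwA : ∀ n, h1Norm (w n) ≤ A) (hdA : ∀ n, h1Norm (d n) ≤ A)
    (hlim : ∀ᵐ x, Tendsto (fun n => fn (d n) x) atTop (𝓝 0))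
    (hfi : ∀ n, Integrable fun x => f (fn (w n) x) * fn (d n) x) {ε : ℝ} (hε : 0 < ε) :
    ∀ᶠ n in atTop, (∫ x, f (fn (w n) x) * fn (d n) x) + m * (∫ x, fn (w n) x * fn (d n) x) ≤ ε := by
  have hN1 : 1 ≤ N := by omega
  have hA : 0 ≤ A := (h1Norm_nonneg (w 0)).trans (hwA 0)
  obtain ⟨C, hC, -, hcs⟩ := exists_weighted_cauchySchwarz hN
  -- A third of ε goes to the singular weight (ε₁), a third to the tail of v (η), and a third to the
  -- ball, where the integral tends to 0. The 1 added to each denominator keeps it positive.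
  obtain ⟨ε₁, hε₁, hε₁'⟩ : ∃ ε₁ > 0, ε₁ * (C * A * A) ≤ ε / 3 :=
    ⟨ε / 3 / (C * A * A + 1), by positivity, by
      rw [div_mul_eq_mul_div, div_le_iff₀ (by positivity)]
      nlinarith⟩
  obtain ⟨η, hη, hη'⟩ : ∃ η > 0, (M + m) * (A * η) ≤ ε / 3 :=
    ⟨ε / 3 / ((M + m) * A + 1), by positivity, by
      rw [← mul_assoc, mul_div_assoc', div_le_iff₀ (by positivity)]
      nlinarith⟩
  obtain ⟨D, hD, hsub⟩ := exists_subcritical_bound hN h1 h3 A hε₁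
  -- The bound δ/(A + 1) ensures |w_n| ≤ Aδ/(A + 1) ≤ δ outside the ball.
  obtain ⟨R₁, -, hR₁⟩ := exists_radialBound_le hN (δ := δ / (A + 1)) (by positivity)
  obtain ⟨R₂, hR₂⟩ := exists_tail_integral_lt v (η := η ^ 2) (by positivity)
  obtain ⟨R, hRR₁, hRR₂⟩ : ∃ R, R₁ ≤ R ∧ R₂ ≤ R := ⟨max R₁ R₂, le_max_left _ _, le_max_right _ _⟩
  obtain ⟨hi3, ht3⟩ := tendsto_integral_ball hN hw hd hwA hdA hlim hD hm.le R
  have hS : MeasurableSet (Metric.ball (0 : Space N) R) := measurableSet_ball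
  have hvmem : MemLp ((Metric.ball (0 : Space N) R)ᶜ.indicator fun x => |fn v x|) 2 volume :=
    (memLp_fn v).norm.indicator hS.compl
  have hvsq : √(∫ x, ((Metric.ball (0 : Space N) R)ᶜ.indicator (fun x => |fn v x|) x) ^ 2) ≤ η := by
    have e : (fun x => ((Metric.ball (0 : Space N) R)ᶜ.indicator (fun x => |fn v x|) x) ^ 2) =
        (Metric.ball (0 : Space N) R)ᶜ.indicator fun x => fn v x ^ 2 := by
      ext x
      by_cases h : x ∈ (Metric.ball (0 : Space N) R)ᶜ
      · rw [Set.indicator_of_mem h, Set.indicator_of_mem h, sq_abs]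
      · rw [Set.indicator_of_notMem h, Set.indicator_of_notMem h]; simp
    rw [e, integral_indicator hS.compl]
    exact Real.sqrt_le_iff.2 ⟨hη.le, (hR₂ R hRR₂).le⟩
  filter_upwards [ht3.eventually (gt_mem_nhds (by positivity : 0 < ε / 3))] with n hn
  have i0 : Integrable fun x => fn (w n) x * fn (d n) x :=
    (memLp_fn (w n)).integrable_mul (q := 2) (memLp_fn (d n))
  have i1 : Integrable fun x => |fn (w n) x *
      (Metric.ball (0 : Space N) R)ᶜ.indicator (fun x => |fn v x|) x| :=
    ((memLp_fn (w n)).integrable_mul (q := 2) hvmem).abs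
  have i2 := (hcs (w n) (d n) (hw n) (hd n)).1
  have i3 := (integrable_indicator_iff hS).2 (hi3 n)
  -- Inside the ball the subcritical bound is used. Outside, d_n = w_n − v and f(w_n)w_n + m w_n² ≤
  -- 0, so only products of w_n with the small tail of v remain.
  have hpt : ∀ᵐ x : Space N, f (fn (w n) x) * fn (d n) x + m * (fn (w n) x * fn (d n) x) ≤
      (M + m) * |fn (w n) x * (Metric.ball (0 : Space N) R)ᶜ.indicator (fun x => |fn v x|) x|
        + ε₁ * (weight N ‖x‖ * |fn (w n) x| * |fn (d n) x|)
        + (Metric.ball (0 : Space N) R).indicator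
          (fun x => (D + m * |fn (w n) x|) * |fn (d n) x|) x := by
    filter_upwards [ae_norm_pos hN1, ae_abs_fn_le hN1 (hw n), hwd n] with x hx hwx hwdx
    have hW := zero_le_one.trans (one_le_weight N hx.le)
    have hwx' : |fn (w n) x| ≤ A * radialBound N ‖x‖ :=
      hwx.trans ((mul_le_mul_of_nonneg_left (hwA n) (radialBound_nonneg N ‖x‖)).trans_eq
        (mul_comm _ _))
    by_cases hxR : x ∈ Metric.ball (0 : Space N) R
    · have hxR' : x ∉ (Metric.ball (0 : Space N) R)ᶜ := fun h => h hxR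
      rw [Set.indicator_of_notMem hxR', Set.indicator_of_mem hxR, mul_zero, abs_zero, mul_zero,
        zero_add]
      have h4 := hsub _ hx _ hwx'
      generalize fn (w n) x = s at *
      generalize fn (d n) x = t at *
      calc f s * t + m * (s * t) ≤ |f s| * |t| + m * (|s| * |t|) := by
            rw [← abs_mul, ← abs_mul]
            gcongr <;> exact le_abs_self _
        _ ≤ (ε₁ * |s| * weight N ‖x‖ + D) * |t| + m * (|s| * |t|) := by gcongr
        _ = _ := by ring
    · rw [Set.indicator_of_mem (show x ∈ (Metric.ball (0 : Space N) R)ᶜ from hxR),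
        Set.indicator_of_notMem hxR, add_zero]
      generalize fn (w n) x = s at *
      generalize fn (d n) x = t at *
      have hxR' : R ≤ ‖x‖ := by simpa using hxR
      have hs : |s| ≤ δ := by
        refine hwx'.trans ?_
        calc A * radialBound N ‖x‖ ≤ A * (δ / (A + 1)) := by
              gcongr; exact hR₁ _ (hRR₁.trans hxR')
          _ ≤ δ := by
              rw [mul_div_assoc', div_le_iff₀ (by positivity)]
              nlinarith
      obtain ⟨h4, h5⟩ := hf s hs
      have ht : t = s - fn v x := by rw [hwdx]; ring
      have h6 : -(f s * fn v x) ≤ M * |s| * |fn v x| := by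
        calc -(f s * fn v x) ≤ |f s * fn v x| := neg_le_abs _
          _ = |f s| * |fn v x| := abs_mul _ _
          _ ≤ _ := by gcongr
      have h7 : -(s * fn v x) ≤ |s| * |fn v x| := by
        rw [← abs_mul]; exact neg_le_abs _
      have h8 : 0 ≤ ε₁ * (weight N ‖x‖ * |s| * |t|) := by positivity
      have h9 : |s * (|fn v x|)| = |s| * |fn v x| := by rw [abs_mul, abs_abs]
      rw [h9]
      have h10 : f s * t + m * (s * t) =
          (f s * s + m * s ^ 2) + (-(f s * fn v x) + m * (-(s * fn v x))) := by
        rw [ht]; ring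
      have h11 := mul_le_mul_of_nonneg_left h7 hm.le
      rw [h10]
      linarith
  have e1 : (∫ x, f (fn (w n) x) * fn (d n) x) + m * (∫ x, fn (w n) x * fn (d n) x) =
      ∫ x, (f (fn (w n) x) * fn (d n) x + m * (fn (w n) x * fn (d n) x)) := by
    rw [integral_add (hfi n) (i0.const_mul m), integral_const_mul]
  have e2 : ∫ x, ((M + m) * |fn (w n) x *
        (Metric.ball (0 : Space N) R)ᶜ.indicator (fun x => |fn v x|) x|
        + ε₁ * (weight N ‖x‖ * |fn (w n) x| * |fn (d n) x|)
        + (Metric.ball (0 : Space N) R).indicator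
          (fun x => (D + m * |fn (w n) x|) * |fn (d n) x|) x) =
      (M + m) * (∫ x, |fn (w n) x *
        (Metric.ball (0 : Space N) R)ᶜ.indicator (fun x => |fn v x|) x|)
        + ε₁ * (∫ x, weight N ‖x‖ * |fn (w n) x| * |fn (d n) x|)
        + ∫ x in Metric.ball (0 : Space N) R, (D + m * |fn (w n) x|) * |fn (d n) x| := by
    rw [integral_add (by exact (i1.const_mul _).add (i2.const_mul _)) i3,
      integral_add (i1.const_mul _) (i2.const_mul _), integral_const_mul, integral_const_mul,
      integral_indicator hS]
  have b1 : ∫ x, |fn (w n) x * (Metric.ball (0 : Space N) R)ᶜ.indicator (fun x => |fn v x|) x| ≤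
      A * η := by
    refine (integral_abs_mul_le_sqrt (memLp_fn (w n)) hvmem).trans ?_
    gcongr
    exact Real.sqrt_le_iff.2 ⟨hA, (integral_fn_sq_le (w n)).trans (by
      have := hwA n
      have := h1Norm_nonneg (w n)
      change h1Norm (w n) ^ 2 ≤ A ^ 2
      gcongr)⟩
  have b2 : ∫ x, weight N ‖x‖ * |fn (w n) x| * |fn (d n) x| ≤ C * A * A := by
    refine (hcs (w n) (d n) (hw n) (hd n)).2.trans ?_
    have := h1Norm_nonneg (d n)
    gcongr
    · exact hwA n
    · exact hdA n
  rw [e1]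
  refine (integral_mono_ae ((hfi n).add (i0.const_mul m))
    (((i1.const_mul _).add (i2.const_mul _)).add i3) hpt).trans (e2.trans_le ?_)
  have b1' : (M + m) * (∫ x, |fn (w n) x *
      (Metric.ball (0 : Space N) R)ᶜ.indicator (fun x => |fn v x|) x|) ≤ (M + m) * (A * η) := by
    gcongr
  have b2' : ε₁ * (∫ x, weight N ‖x‖ * |fn (w n) x| * |fn (d n) x|) ≤ ε₁ * (C * A * A) := by
    gcongr
  linarith

/-- The scalar inequality that turns the Palais-Smale condition into strong convergence. -/
theorem tendsto_zero_of_palaisSmale_ineq {a b m B g : ℝ} (ha : 0 ≤ a) (hb : 0 < b) (hm : 0 < m)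
    (hg : 0 ≤ g) {s t p q E F : ℕ → ℝ} (hs : ∀ n, 0 ≤ s n) (ht : ∀ n, 0 ≤ t n)
    (hsB : ∀ n, s n ≤ B) (hAB : ∀ n, s n + 2 * p n + g ≤ B) (hA0 : ∀ n, 0 ≤ s n + 2 * p n + g)
    (hp : Tendsto p atTop (𝓝 0)) (hq : Tendsto q atTop (𝓝 0)) (hE : Tendsto E atTop (𝓝 0))
    (hEF : ∀ n, E n = (a + b * (s n + 2 * p n + g)) * (s n + p n) - F n)
    (hF : ∀ ε > 0, ∀ᶠ n in atTop, F n + m * (t n + q n) ≤ ε) :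
    Tendsto (fun n => s n + t n) atTop (𝓝 0) := by
  have hB : 0 ≤ B := (hs 0).trans (hsB 0)
  -- Expanding E isolates b s² + m t; every other term tends to 0, has small upper limit, or is one
  -- of a s, b g s ≥ 0, which are dropped with a favourable sign.
  have key : ∀ ε > 0, ∀ᶠ n in atTop, b * s n ^ 2 + m * t n ≤ ε := by
    intro ε hε
    have hr : Tendsto (fun n => |E n| + (a + b * B) * |p n| + m * |q n| + 2 * b * B * |p n|) atTop
        (𝓝 0) := by
      simpa using ((hE.abs.add (hp.abs.const_mul (a + b * B))).add (hq.abs.const_mul m)).add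
        (hp.abs.const_mul (2 * b * B))
    filter_upwards [hF (ε / 2) (by positivity),
      hr.eventually (gt_mem_nhds (by positivity : 0 < ε / 2))] with n h1 h2
    have h3 : -((a + b * (s n + 2 * p n + g)) * p n) ≤ (a + b * B) * |p n| := by
      calc _ ≤ |(a + b * (s n + 2 * p n + g)) * p n| := neg_le_abs _
        _ = (a + b * (s n + 2 * p n + g)) * |p n| := by
          rw [abs_mul, abs_of_nonneg (by have := hA0 n; positivity)]
        _ ≤ _ := by gcongr; exact hAB n
    have h4 : -(2 * b * s n * p n) ≤ 2 * b * B * |p n| := by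
      have := hs n
      calc _ ≤ |2 * b * s n * p n| := neg_le_abs _
        _ = 2 * b * s n * |p n| := by rw [abs_mul, abs_of_nonneg (by positivity)]
        _ ≤ _ := by gcongr; exact hsB n
    have h5 : -(m * q n) ≤ m * |q n| := by
      rw [← mul_neg]; gcongr; exact neg_le_abs _
    have h6 := hEF n
    have h7 := le_abs_self (E n)
    have h8 : 0 ≤ a * s n + b * g * s n := by
      have := hs n
      positivity
    have h9 : b * s n ^ 2 + m * t n = E n + (F n + m * (t n + q n))
        - (a + b * (s n + 2 * p n + g)) * p n - m * q n - 2 * b * s n * p n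
        - (a * s n + b * g * s n) := by rw [h6]; ring
    linarith
  rw [Metric.tendsto_nhds]
  intro ε hε
  filter_upwards [key (min (b * (ε / 4) ^ 2) (m * (ε / 4))) (by positivity)] with n hn
  have h1 := hs n
  have h2 := ht n
  have h3 : b * s n ^ 2 ≤ b * (ε / 4) ^ 2 := by
    have := hn.trans (min_le_left _ _)
    have : 0 ≤ m * t n := by positivity
    linarith
  have h4 : m * t n ≤ m * (ε / 4) := by
    have := hn.trans (min_le_right _ _)
    have : 0 ≤ b * s n ^ 2 := by positivity
    linarith
  have h5 : s n ≤ ε / 4 :=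
    (pow_le_pow_iff_left₀ h1 (by positivity) two_ne_zero).1 (le_of_mul_le_mul_left h3 hb)
  have h6 : t n ≤ ε / 4 := le_of_mul_le_mul_left h4 hm
  rw [Real.dist_eq, sub_zero, abs_of_nonneg (by linarith)]
  linarith


end Kirchhoff

/-! ### Strong convergence. -/

namespace Kirchhoff

variable {N : ℕ} {f : ℝ → ℝ}

/-- Weakly null sequences of radial functions converge to zero almost everywhere. -/
theorem ae_tendsto_zero_of_weak (hN : 1 ≤ N) {d : ℕ → H1 N} (hd : ∀ n, IsRadial (d n))
    (hweak : ∀ z : Ambient N, Tendsto (fun n => ⟪(d n).1, z⟫) atTop (𝓝 0)) :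
    ∀ᵐ x, Tendsto (fun n => fn (d n) x) atTop (𝓝 0) := by
  filter_upwards [ae_norm_pos hN, ae_all_iff.2 fun n => ae_eq_radialMean hN (hd n)] with x hx h
  -- At almost every point, evaluation is a fixed multiple of the inner product with κ, so weak
  -- convergence can be tested there.
  obtain ⟨κ, -, hκ⟩ := exists_radialMean_eq_inner hN hx
  have hσ := (sphereArea_pos hN).ne'
  have h1 := (hweak κ).const_mul (sphereArea N)⁻¹
  rw [mul_zero] at h1
  refine h1.congr fun n => ?_
  rw [real_inner_comm, ← hκ, ← h n, inv_mul_cancel_left₀ hσ]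

theorem h1Norm_sq_eq_integral (w : H1 N) :
    h1Norm w ^ 2 = ‖gradL N w‖ ^ 2 + ∫ x, fn w x ^ 2 := by
  rw [h1Norm_sq, ← norm_fst_sq, add_comm]
  rfl

theorem inner_toLp_gradL (w v : H1 N) :
    ⟪w.1, (WithLp.toLp 2 ((0 : Lp ℝ 2 (volume : Measure (Space N))), gradL N v) : Ambient N)⟫ =
      ⟪gradL N w, gradL N v⟫ := by
  rw [WithLp.prod_inner_apply]
  simp only [inner_zero_right, zero_add]
  rfl

theorem inner_toLp_fst (w v : H1 N) :
    ⟪w.1, (WithLp.toLp 2 (v.1.fst, (0 : Lp (Space N) 2 (volume : Measure (Space N)))) :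
      Ambient N)⟫ = ∫ x, fn v x * fn w x := by
  rw [WithLp.prod_inner_apply]
  simp only [inner_zero_right, add_zero]
  rw [L2.inner_def]
  rfl

theorem norm_sq_add_expand {E : Type*} [NormedAddCommGroup E] [InnerProductSpace ℝ E] (x y : E) :
    ‖y‖ ^ 2 + 2 * ⟪y, x⟫ + ‖x‖ ^ 2 = ‖x + y‖ ^ 2 := by
  rw [add_comm x y, norm_add_sq_real]

theorem norm_sq_add_inner {E : Type*} [NormedAddCommGroup E] [InnerProductSpace ℝ E] (x y : E) :
    ‖y‖ ^ 2 + ⟪y, x⟫ = ⟪x + y, y⟫ := by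
  rw [inner_add_left, real_inner_self_eq_norm_sq, real_inner_comm, add_comm]

/-- Along weakly convergent bounded sequences, the Palais-Smale condition tested with the
increments forces strong convergence. -/
theorem tendsto_h1Norm_of_weak (hN : 2 ≤ N) {a b : ℝ} (ha : 0 ≤ a) (hb : 0 < b)
    (h1 : F1 f) (h2 : F2 f) (h3 : F3 N f) {v : H1 N} {w d : ℕ → H1 N} {A : ℝ}
    (hw : ∀ n, IsRadial (w n)) (hd : ∀ n, IsRadial (d n)) (hwd : ∀ n, w n = v + d n)
    (hwA : ∀ n, h1Norm (w n) ≤ A) (hdA : ∀ n, h1Norm (d n) ≤ A)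
    (hweak : ∀ z : Ambient N, Tendsto (fun n => ⟪(d n).1, z⟫) atTop (𝓝 0))
    (hE : Tendsto (fun n => (a + b * ‖gradL N (w n)‖ ^ 2) * ⟪gradL N (w n), gradL N (d n)⟫
      - ∫ x, f (fn (w n) x) * fn (d n) x) atTop (𝓝 0)) :
    Tendsto (fun n => h1Norm (d n)) atTop (𝓝 0) := by
  obtain ⟨m, M, δ, hm, hM, hδ, hf⟩ := exists_linear_near_zero h1 h2
  have hA : 0 ≤ A := (h1Norm_nonneg (w 0)).trans (hwA 0)
  have hgrad : ∀ w : H1 N, h1Norm w ≤ A → ‖gradL N w‖ ^ 2 ≤ A ^ 2 := fun w hwA => by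
    have e := h1Norm_sq_eq_integral w
    have : 0 ≤ ∫ x, fn w x ^ 2 := integral_nonneg fun x => sq_nonneg _
    have : h1Norm w ^ 2 ≤ A ^ 2 := pow_le_pow_left₀ (h1Norm_nonneg w) hwA 2
    linarith
  have hp : Tendsto (fun n => ⟪gradL N (d n), gradL N v⟫) atTop (𝓝 0) :=
    (hweak _).congr fun n => inner_toLp_gradL (d n) v
  have hq : Tendsto (fun n => ∫ x, fn v x * fn (d n) x) atTop (𝓝 0) :=
    (hweak _).congr fun n => inner_toLp_fst (d n) v
  have hsum : ∀ n, gradL N (w n) = gradL N v + gradL N (d n) := fun n =>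
    (congrArg (gradL N) (hwd n)).trans ((gradL N).map_add v (d n))
  have hexp : ∀ n, ‖gradL N (d n)‖ ^ 2 + 2 * ⟪gradL N (d n), gradL N v⟫ + ‖gradL N v‖ ^ 2 =
      ‖gradL N (w n)‖ ^ 2 := fun n =>
    (norm_sq_add_expand _ _).trans (congrArg (fun y => ‖y‖ ^ 2) (hsum n).symm)
  have hin : ∀ n, ‖gradL N (d n)‖ ^ 2 + ⟪gradL N (d n), gradL N v⟫ =
      ⟪gradL N (w n), gradL N (d n)⟫ := fun n =>
    (norm_sq_add_inner _ _).trans (congrArg (fun y => ⟪y, gradL N (d n)⟫) (hsum n).symm)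
  have hfn : ∀ n, fn (w n) =ᵐ[volume] fun x => fn v x + fn (d n) x := fun n => by
    rw [hwd n]
    exact fn_add v (d n)
  have hwdi : ∀ n, (∫ x, fn (d n) x ^ 2) + (∫ x, fn v x * fn (d n) x) =
      ∫ x, fn (w n) x * fn (d n) x := fun n => by
    have hi : Integrable fun x => fn v x * fn (d n) x :=
      (memLp_fn v).integrable_mul (q := 2) (memLp_fn (d n))
    rw [← integral_add (integrable_fn_sq (d n)) hi]
    refine integral_congr_ae ?_
    filter_upwards [hfn n] with x hx
    rw [hx]
    ring
  -- Here s and t are the squared L² norms of ∇d_n and d_n, while p and q are their cross terms with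
  -- v, null by weak convergence.
  have hsq := tendsto_zero_of_palaisSmale_ineq (B := A ^ 2) (g := ‖gradL N v‖ ^ 2)
    (s := fun n => ‖gradL N (d n)‖ ^ 2) (t := fun n => ∫ x, fn (d n) x ^ 2)
    (p := fun n => ⟪gradL N (d n), gradL N v⟫) (q := fun n => ∫ x, fn v x * fn (d n) x)
    (F := fun n => ∫ x, f (fn (w n) x) * fn (d n) x)
    ha hb hm (sq_nonneg _) (fun n => sq_nonneg _)
    (fun n => integral_nonneg fun x => sq_nonneg _) (fun n => hgrad _ (hdA n))
    (fun n => (hexp n).trans_le (hgrad _ (hwA n)))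
    (fun n => (sq_nonneg _).trans_eq (hexp n).symm) hp hq hE
    (fun n => congrArg₂ (fun x y => (a + b * x) * y - ∫ x, f (fn (w n) x) * fn (d n) x)
      (hexp n).symm (hin n).symm)
    (fun ε hε => by
      simp only [hwdi]
      exact eventually_integral_nonlinear_le hN h1 h3 hm hM hδ hf hw hd hfn hwA hdA
        (ae_tendsto_zero_of_weak (by omega) hd hweak)
        (fun n => integrable_comp_mul_fn hN h1 h2 h3 (hw n) (hd n)) hε)
  have h4 := (hsq.congr fun n => (h1Norm_sq_eq_integral (d n)).symm).sqrt
  rw [Real.sqrt_zero] at h4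
  exact h4.congr fun n => Real.sqrt_sq (h1Norm_nonneg _)

/-- The Palais-Smale condition for bounded sequences, on any space isometric to the radial
functions. -/
theorem IsPalaisSmale.exists_tendsto (hN : 2 ≤ N) {a b : ℝ} (ha : 0 ≤ a) (hb : 0 < b)
    (h1 : F1 f) (h2 : F2 f) (h3 : F3 N f) {X : Type*} [NormedAddCommGroup X] [NormedSpace ℝ X]
    {Φ : X → ℝ} {u : ℕ → X} (hu : IsPalaisSmale Φ u) {C : ℝ} (hC : ∀ n, ‖u n‖ ≤ C)
    (ι : X →ₗᵢ[ℝ] H1 N) (hΦ : Φ = pullbackEnergy a b f ι) (hι : ∀ x, IsRadial (ι x))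
    (hsurj : ∀ w, IsRadial w → ∃ x, ι x = w) :
    ∃ (v : X) (k : ℕ → ℕ), StrictMono k ∧ Tendsto (fun n => u (k n)) atTop (𝓝 v) := by
  subst hΦ
  have hPS := hu.2
  have hnorm : ∀ x, h1Norm (ι x) = ‖x‖ := fun x => ι.norm_map x
  obtain ⟨v', k, hv', hk, hlim⟩ := exists_radial_weak_limit (w := fun n => ι (u n))
    (fun n => hι _) (A := C) (fun n => (hnorm _).trans_le (hC n))
  obtain ⟨v, hv⟩ := hsurj v' hv'
  have hC0 : 0 ≤ C := (norm_nonneg _).trans (hC 0)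
  have hdC : ∀ n, ‖u (k n) - v‖ ≤ C + ‖v‖ := fun n =>
    (norm_sub_le _ _).trans (by gcongr; exact hC _)
  refine ⟨v, k, hk, tendsto_iff_norm_sub_tendsto_zero.2 ?_⟩
  have hsub : ∀ n, ι (u (k n) - v) = ι (u (k n)) - v' := fun n =>
    (ι.map_sub _ _).trans (congrArg (ι (u (k n)) - ·) hv)
  -- The increments u(k n) − v are bounded, so derivatives tending to 0 in the dual norm can be
  -- tested against them.
  have hE : Tendsto (fun n => fderiv ℝ (pullbackEnergy a b f ι) (u (k n)) (u (k n) - v)) atTop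
      (𝓝 0) := by
    refine squeeze_zero_norm (a := fun n =>
      ‖fderiv ℝ (pullbackEnergy a b f ι) (u (k n))‖ * (C + ‖v‖)) (fun n => ?_) ?_
    · exact (ContinuousLinearMap.le_opNorm _ _).trans (by gcongr; exact hdC n)
    · simpa using ((hPS.comp hk.tendsto_atTop).norm).mul_const (C + ‖v‖)
  have hfd : ∀ n, fderiv ℝ (pullbackEnergy a b f ι) (u (k n)) (u (k n) - v) =
      (a + b * ‖gradL N (ι (u (k n)))‖ ^ 2) *
        ⟪gradL N (ι (u (k n))), gradL N (ι (u (k n) - v))⟫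
      - ∫ x, f (fn (ι (u (k n))) x) * fn (ι (u (k n) - v)) x := fun n => by
    obtain ⟨L, hL⟩ := exists_force_functional hN h1 h2 h3 hι (u (k n))
    have := (hasFDerivAt_pullbackEnergy hN a b h1 h2 h3 hι hL
      (G := (gradL N).comp ι.toContinuousLinearMap) fun _ => rfl).fderiv
    exact (DFunLike.congr_fun this _).trans (congrArg (_ - ·) (hL _))
  refine (tendsto_h1Norm_of_weak hN ha hb h1 h2 h3 (v := v') (w := fun n => ι (u (k n)))
    (d := fun n => ι (u (k n) - v)) (A := C + ‖v‖) (fun n => hι _) (fun n => hι _)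
    (fun n => ?_) (fun n => ?_) (fun n => (hnorm _).trans_le (hdC n)) (fun z => ?_)
    (hE.congr hfd)).congr fun n => hnorm _
  · exact ((congrArg (v' + ·) (hsub n)).trans (add_sub_cancel _ _)).symm
  · exact (hnorm _).trans_le ((hC _).trans (le_add_of_nonneg_right (norm_nonneg v)))
  · have h4 := (hlim z).sub_const ⟪v'.1, z⟫
    rw [sub_self] at h4
    exact h4.congr fun n => (inner_sub_left _ _ _).symm.trans
      (congrArg (fun y : H1 N => ⟪y.1, z⟫) (hsub n).symm)

end Kirchhoff

/-- The abstract space is H¹_r itself with its inclusion as the isometry; `energy` is then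
definitionally `pullbackEnergy`. -/
theorem lemma2p5 (N : ℕ) (hN : 2 ≤ N) (a b : ℝ) (ha : 0 ≤ a) (hb : 0 < b)
    (f : ℝ → ℝ) (hf1 : Kirchhoff.F1 f) (hf2 : Kirchhoff.F2 f) (hf3 : Kirchhoff.F3 N f)
    (u : ℕ → Kirchhoff.H1r N) (hbdd : ∃ C : ℝ, ∀ n, ‖u n‖ ≤ C)
    (hPS : Kirchhoff.IsPalaisSmale (Kirchhoff.energy N a b f) u) :
    ∃ (v : Kirchhoff.H1r N) (k : ℕ → ℕ),
      StrictMono k ∧ Tendsto (fun n => u (k n)) atTop (𝓝 v) :=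
  have ⟨_, hC⟩ := hbdd
  @Kirchhoff.IsPalaisSmale.exists_tendsto N f hN a b ha hb hf1 hf2 hf3 _ _ _ _ u hPS _ hC
    (Kirchhoff.H1r N).subtypeₗᵢ rfl (fun x => x.2) (fun w hw => ⟨⟨w, hw⟩, rfl⟩)
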